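/- \textbf{Setting.} Two parallel arcs $r=1,2$ have per-unit cost functions $c_1,c_2$ which, on an open interval $\Omega\supseteq[0,\bar M]$ ($\bar M>0$), are strictly increasing, convex and continuously differentiable, and which are non-negative on $[0,\bar M]$. The players are nonatomic players of total weight $T^0\ge 0$ and $N\ge 1$ atomic players of weights $T^1,\dots,T^N>0$; put $M=\sum_{i=0}^N T^i$ and assume $M<\bar M$. Assume either $c_1(M)<c_2(0)$, or $c_1(M)\ge c_2(0)$, $c_2(M)\ge c_1(0)$ and $\hat\xi c_1'(\hat\xi)\ge (M-\hat\xi)c_2'(M-\hat\xi)$, where $\hat\xi\in[0,M]$ is the (unique) number with $c_1(\hat\xi)=c_2(M-\hat\xi)$. In a flow, every player group or atomic player $i$ splits its weight as $x^i_1+x^i_2$ with $x^i_r\ge 0$, and $\xi_r=\sum_i x^i_r$. A composite equilibrium (CE) is a flow in which nonatomic players use only arcs of minimal cost $c_r(\xi_r)$ and every atomic player $i$ minimizes $x^i_1c_1(\xi_1)+x^i_2c_2(\xi_2)$ over her own splittings, given the others' flows. A decentralization strategy of atomic player $N$ is a tuple $\alpha=(\alpha^0,\alpha^1,\dots,\alpha^n)$,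 $n\ge 0$, with $\alpha^0\ge 0$, $\alpha^1\ge\dots\ge\alpha^n>0$ and $\sum_{i=0}^n\alpha^i=T^N$: she is replaced by nonatomic deputies of total weight $\alpha^0$ and $n$ atomic deputies of weights $\alpha^1,\dots,\alpha^n$. Her cost $U^N(\alpha)$ is the total cost to her deputies at the CE of the resulting game against $T^0,T^1,\dots,T^{N-1}$. Strategies with the same cost are called equivalent; a strategy is optimal if it minimizes $U^N$ over all strategies. The nonatomic strategy has $n=0$; the trivial one has $n=1$, $\alpha^1=T^N$ (no decentralization); for $s\in[0,T^N]$ the single-atomic (SA) strategy $s$ has one atomic deputy, of weight $s$ (none if $s=0$), the rest being nonatomic. Put $$H=\frac{c_2(0)-c_1(M)}{c_1'(M)},\qquad h(t)=\frac{c_2(M-t)-c_1(t)}{c_1'(t)}.$$ \textbf{Theorem.} Every game induced by a strategy of player $N$ has a unique CE, and $U^N$ is well defined. The cost $U^N(s)$ of the SA strategy $s$ is continuous in $s\in[0,T^N]$, and player $N$ has an optimal decentralization strategy, which can be chosen to be SA. More precisely, there are constants $C_0>0$, $C_1\ge 0$ (with $C_1>0$ unless $H=0$) and $C_2>0$, determined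 by $c_1,c_2$, $M$ and $T^1,\dots,T^{N-1}$, such that the following holds. 1 (nonatomic). Every strategy of player $N$ is optimal and equivalent to the nonatomic strategy if one of the following holds: (1.1) $H>0$ and either (i) $T^i\le H$ for all $1\le i\le N$, or (ii) $N>1$, $\max_{1\le i\le N-1}T^i>H$ and $T^N\le C_0$; (1.2) $H\le 0$ and either (i) $\sum_{i=1}^N T^i\le C_1$, or (ii) $N>1$, $\sum_{i=1}^{N-1}T^i>C_1$ and $T^N\le C_2$. 2 (trivial). The trivial strategy is the unique optimal strategy of player $N$ if one of the following holds: (2.1) $H>0$, $T^N>H$, and $\max_{1\le i\le N-1}T^i\le H$ in the case $N>1$; (2.2) $H\le 0$, $N=1$ and $T^N>C_1$. 3 (nontrivial). In all remaining situations player $N$ has at least one optimal strategy. It is not necessarily nonatomic or trivial: there are instances in which neither the nonatomic nor the trivial strategy is optimal. Explicitly, one can take $C_1=(M-\hat\xi)\bigl(1+c_2'(M-\hat\xi)/c_1'(\hat\xi)\bigr)$ when $H\le 0$, and, in the situations (1.1)(ii) and (1.2)(ii) in which they are used, $C_0$ and $C_2$ equal to $h(\xi_1)$, where $\xi_1$ is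 the weight on arc 1 at the CE of the game induced by the nonatomic strategy (this $\xi_1$ depends on the players only through $M$ and $T^1,\dots,T^{N-1}$). -/

import Mathlib

open Set

noncomputable section

namespace CompositeCongestion

/-! ### Binary choice composite congestion games

The two parallel arcs are indexed by `Fin 2`: arc 1 is `0`, arc 2 is `1`. -/

/-- Feasible flows of stock `w`: splittings of `w` over the two arcs. -/
def feasible (w : ℝ) : Set (Fin 2 → ℝ) := {x | (∀ r, 0 ≤ x r) ∧ ∑ r, x r = w}

/-- A system flow: the flow of the nonatomic players and that of each atomic player `i : ι`. -/
@[ext]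
structure Flow (ι : Type) where
  nonatomic : Fin 2 → ℝ
  atomic : ι → Fin 2 → ℝ

section Game

variable {ι : Type} [Fintype ι] [DecidableEq ι]

/-- The aggregate weight `ξ_r` on arc `r`. -/
def Flow.load (x : Flow ι) (r : Fin 2) : ℝ := x.nonatomic r + ∑ i, x.atomic i r

/-- The cost `u^i` to atomic player `i`. -/
def atomicCost (c : Fin 2 → ℝ → ℝ) (x : Flow ι) (i : ι) : ℝ :=
  ∑ r, x.atomic i r * c r (x.load r)

/-- The flow obtained when atomic player `i` switches to `y`, all others unchanged. -/
def Flow.deviate (x : Flow ι) (i : ι) (y : Fin 2 → ℝ) : Flow ι :=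
  ⟨x.nonatomic, Function.update x.atomic i y⟩

/-- Composite equilibrium of the game with per-unit arc costs `c`, nonatomic players of total
weight `T₀` and atomic players of weights `T i`. -/
structure IsCE (c : Fin 2 → ℝ → ℝ) (T₀ : ℝ) (T : ι → ℝ) (x : Flow ι) : Prop where
  nonatomic_mem : x.nonatomic ∈ feasible T₀
  atomic_mem : ∀ i, x.atomic i ∈ feasible (T i)
  wardrop : ∀ r, 0 < x.nonatomic r → ∀ s, c r (x.load r) ≤ c s (x.load s)
  nash : ∀ i, ∀ y ∈ feasible (T i), atomicCost c x i ≤ atomicCost c (x.deviate i y) i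

end Game

/-! ### Standing assumptions on the costs -/

/-- The assumption on a single arc cost function, defined on `Ω ⊇ [0, Mbar]`. -/
structure IsArcCost (Ω : Set ℝ) (Mbar : ℝ) (c : ℝ → ℝ) : Prop where
  strictMonoOn : StrictMonoOn c Ω
  convexOn : ConvexOn ℝ Ω c
  contDiffOn : ContDiffOn ℝ 1 c Ω
  nonneg : ∀ t ∈ Icc 0 Mbar, 0 ≤ c t

/-- `ξ` is the weight on arc 1 at which both arcs cost the same (the number `ξ̂`). -/
def IsBalanced (c₁ c₂ : ℝ → ℝ) (M ξ : ℝ) : Prop :=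
  ξ ∈ Icc 0 M ∧ c₁ ξ = c₂ (M - ξ)

/-- All standing assumptions on the network and on the total weight `M` of the players. -/
structure IsNetwork (c₁ c₂ : ℝ → ℝ) (Ω : Set ℝ) (Mbar M : ℝ) : Prop where
  isOpen : IsOpen Ω
  subset : Icc 0 Mbar ⊆ Ω
  Mbar_pos : 0 < Mbar
  lt_Mbar : M < Mbar
  arc₁ : IsArcCost Ω Mbar c₁
  arc₂ : IsArcCost Ω Mbar c₂
  arc₁_cheaper : c₁ M < c₂ 0 ∨
    (c₂ 0 ≤ c₁ M ∧ c₁ 0 ≤ c₂ M ∧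
      ∃ ξ, IsBalanced c₁ c₂ M ξ ∧ (M - ξ) * deriv c₂ (M - ξ) ≤ ξ * deriv c₁ ξ)

/-! ### Decentralization strategies -/

/-- Decentralization strategies of an atomic player of weight `w`: nonatomic deputies of total
weight `nonatomic`, and `n` atomic deputies of positive, non-increasing weights. -/
@[ext]
structure Strategy (w : ℝ) where
  n : ℕ
  nonatomic : ℝ
  atomic : Fin n → ℝ
  nonatomic_nonneg : 0 ≤ nonatomic
  atomic_pos : ∀ i, 0 < atomic i
  antitone : Antitone atomic
  total : nonatomic + ∑ i, atomic i = w

/-- The nonatomic strategy: no atomic deputy. -/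
def Strategy.allNonatomic {w : ℝ} (hw : 0 ≤ w) : Strategy w where
  n := 0
  nonatomic := w
  atomic := Fin.elim0
  nonatomic_nonneg := hw
  atomic_pos := fun i => i.elim0
  antitone := fun i => i.elim0
  total := by simp

/-- The strategy with exactly one atomic deputy, of weight `s ∈ (0, w]`. -/
def Strategy.oneAtomic {w : ℝ} (s : ℝ) (hs : 0 < s) (hsw : s ≤ w) : Strategy w where
  n := 1
  nonatomic := w - s
  atomic := fun _ => s
  nonatomic_nonneg := sub_nonneg.2 hsw
  atomic_pos := fun _ => hs
  antitone := fun _ _ _ => le_rfl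
  total := by simp

/-- The trivial strategy: a single atomic deputy with the whole weight (no decentralization). -/
def Strategy.trivial {w : ℝ} (hw : 0 < w) : Strategy w := Strategy.oneAtomic w hw le_rfl

/-- The single-atomic (SA) strategy `s ∈ [0, w]`: one atomic deputy of weight `s` if `s > 0`,
and the nonatomic strategy if `s = 0`. -/
def Strategy.singleAtomic {w : ℝ} (s : Icc (0 : ℝ) w) : Strategy w :=
  if hs : 0 < (s : ℝ) then Strategy.oneAtomic s hs s.2.2
  else Strategy.allNonatomic (s.2.1.trans s.2.2)

section Induced

variable (c : Fin 2 → ℝ → ℝ) (T₀ : ℝ) {m : ℕ} (T : Fin m → ℝ) {w : ℝ}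

/-- `z` is a composite equilibrium of the game induced by strategy `α` against opponents
consisting of nonatomic players of total weight `T₀` and atomic players of weights `T`. -/
def IsInducedCE (α : Strategy w) (z : Flow (Fin α.n ⊕ Fin m)) : Prop :=
  IsCE c (α.nonatomic + T₀) (Sum.elim α.atomic T) z

/-- `u` is the total cost to the deputies at an induced composite equilibrium `z`.  The nonatomic
flow of `z` is the sum of the flow `x₀` of the nonatomic deputies and the flow
`z.nonatomic - x₀` of the nonatomic opponents. -/
def IsInducedCost (α : Strategy w) (u : ℝ) : Prop :=
  ∃ (z : Flow (Fin α.n ⊕ Fin m)) (x₀ : Fin 2 → ℝ), IsInducedCE c T₀ T α z ∧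
    x₀ ∈ feasible α.nonatomic ∧ (fun r => z.nonatomic r - x₀ r) ∈ feasible T₀ ∧
    u = ∑ r, (x₀ r + ∑ i, z.atomic (Sum.inl i) r) * c r (z.load r)

/-- The cost `U^N(α, T^{-N})` of strategy `α`: the unique `u` with `IsInducedCost`. -/
def inducedCost (α : Strategy w) : ℝ := Classical.epsilon (IsInducedCost c T₀ T α)

/-- `α` and `β` are equivalent: they yield the same cost. -/
def AreEquivalent (α β : Strategy w) : Prop := inducedCost c T₀ T α = inducedCost c T₀ T β

/-- `α` minimizes the cost over all decentralization strategies. -/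
def IsOptimal (α : Strategy w) : Prop := ∀ β : Strategy w, inducedCost c T₀ T α ≤ inducedCost c T₀ T β

end Induced

/-! ### The thresholds and the cases -/

/-- `H = (c₂(0) - c₁(M)) / c₁'(M)`. -/
def H (c₁ c₂ : ℝ → ℝ) (M : ℝ) : ℝ := (c₂ 0 - c₁ M) / deriv c₁ M

/-- `h(t) = (c₂(M - t) - c₁(t)) / c₁'(t)`. -/
def h (c₁ c₂ : ℝ → ℝ) (M t : ℝ) : ℝ := (c₂ (M - t) - c₁ t) / deriv c₁ t

/-- `C` is the value of `h` at the weight on arc 1 in a composite equilibrium of the game in which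
the atomic players are `T` and the rest of the total weight `M` is nonatomic. -/
def IsOpponentThreshold (c₁ c₂ : ℝ → ℝ) (M : ℝ) {m : ℕ} (T : Fin m → ℝ) (C : ℝ) : Prop :=
  ∃ z : Flow (Fin m), IsCE ![c₁, c₂] (M - ∑ j, T j) T z ∧ C = h c₁ c₂ M (z.load 0)

/-- `C = (M - ξ̂) (1 + c₂'(M - ξ̂) / c₁'(ξ̂))`. -/
def IsBalancedThreshold (c₁ c₂ : ℝ → ℝ) (M C : ℝ) : Prop :=
  ∃ ξ, IsBalanced c₁ c₂ M ξ ∧ C = (M - ξ) * (1 + deriv c₂ (M - ξ) / deriv c₁ ξ)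

/-- The nonatomic case.  The atomic opponents of the player of weight `TN` are `T : Fin m → ℝ`, so
that there are `N = m + 1` atomic players. -/
def NonatomicCase (H C₀ C₁ C₂ : ℝ) {m : ℕ} (T : Fin m → ℝ) (TN : ℝ) : Prop :=
  (0 < H ∧ (((∀ j, T j ≤ H) ∧ TN ≤ H) ∨ (1 < m + 1 ∧ (∃ j, H < T j) ∧ TN ≤ C₀))) ∨
  (H ≤ 0 ∧ ((∑ j, T j) + TN ≤ C₁ ∨ (1 < m + 1 ∧ C₁ < ∑ j, T j ∧ TN ≤ C₂)))

/-- The trivial case. -/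
def TrivialCase (H C₁ : ℝ) {m : ℕ} (T : Fin m → ℝ) (TN : ℝ) : Prop :=
  (0 < H ∧ H < TN ∧ ∀ j, T j ≤ H) ∨ (H ≤ 0 ∧ m + 1 = 1 ∧ C₁ < TN)

end CompositeCongestion

end

noncomputable section

namespace CompositeCongestion

/-! ### Regularity of the arc costs -/

/-! Everything is parametrized by the weight t on arc 1. Equilibrium loads never exceed a cap b,
equal to M if H > 0 and to the balanced weight ξ̂ otherwise. On [0, b] arc 2 is at least as
expensive as arc 1, so equalizing marginal costs makes an atomic player of weight w put (w - h(t))⁺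
/ `damping` t on arc 2. What is left of M - t must be nonatomic; up to the factor `damping` it is
`residual`, which is strictly decreasing in t. Equilibrium means that the residual is nonnegative,
and zero below the cap, so existence follows from the intermediate value theorem and uniqueness from
monotonicity (`exists_isEqLoad`, `IsEqLoad.unique`, `existsUnique_isCE`).

The deputies' total cost is then a function `loadCost` of t alone (`isInducedCost_iff`): a strategy
matters only through the load it induces. Deputies are jointly at most as active as the undivided
player (`activity_le_max`), and a single deputy of suitable weight reproduces any intermediate
activity. Thus SA strategies realize all attainable loads; their costs are continuous on a compact
interval, which gives an optimum.

In the nonatomic case no strategy moves the load. In the trivial case the opponents stay on arc 1 at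
every attainable load, `loadCost` is minimized where the trivial strategy's equilibrium condition
holds, and only the trivial strategy is active enough to reach that load. An affine instance, where
an SA strategy with s = 3 beats both extremes, settles the last claim. -/

/-- The properties of an arc cost on `[0, M]` used below: differentiability with a continuous,
positive, monotone derivative, and the tangent line inequality. -/
structure IsSmoothCost (M : ℝ) (c : ℝ → ℝ) : Prop where
  hasDerivAt : ∀ t ∈ Icc 0 M, HasDerivAt c (deriv c t) t
  deriv_pos : ∀ t ∈ Icc 0 M, 0 < deriv c t
  deriv_mono : MonotoneOn (deriv c) (Icc 0 M)
  continuousOn_deriv : ContinuousOn (deriv c) (Icc 0 M)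
  tangent_le : ∀ s ∈ Icc 0 M, ∀ t ∈ Icc 0 M, c s + deriv c s * (t - s) ≤ c t

theorem IsArcCost.isSmoothCost {Ω : Set ℝ} {Mbar M : ℝ} {c : ℝ → ℝ} (hc : IsArcCost Ω Mbar c)
    (hΩ : IsOpen Ω) (hsub : Icc 0 Mbar ⊆ Ω) (hM : M ≤ Mbar) : IsSmoothCost M c := by
  have hmem : Icc 0 M ⊆ Ω := fun t ht => hsub ⟨ht.1, ht.2.trans hM⟩
  have hd : ∀ t ∈ Ω, HasDerivAt c (deriv c t) t := fun t ht =>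
    ((hc.contDiffOn.differentiableOn (by norm_num)).differentiableAt (hΩ.mem_nhds ht)).hasDerivAt
  have hmono : MonotoneOn (deriv c) Ω :=
    hc.convexOn.monotoneOn_deriv fun t ht => (hd t ht).differentiableAt
  refine ⟨fun t ht => hd t (hmem ht), fun t ht => ?_, hmono.mono hmem,
    (hc.contDiffOn.continuousOn_deriv_of_isOpen hΩ le_rfl).mono hmem, fun s hs t ht => ?_⟩
  -- Openness of Ω supplies a point to the left of t, even for t = 0; the positive slope from it
  -- bounds the derivative from below.
  · obtain ⟨ε, hε, hball⟩ := Metric.isOpen_iff.1 hΩ t (hmem ht)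
    have hs : t - ε / 2 ∈ Ω := hball (by
      rw [Metric.mem_ball, Real.dist_eq, abs_lt]; constructor <;> linarith)
    have hlt : t - ε / 2 < t := by linarith
    refine lt_of_lt_of_le ?_ (hc.convexOn.slope_le_of_hasDerivAt hs (hmem ht) hlt (hd t (hmem ht)))
    rw [slope_def_field]
    exact div_pos (sub_pos.2 (hc.strictMonoOn hs (hmem ht) hlt)) (sub_pos.2 hlt)
  · rcases lt_trichotomy s t with hst | rfl | hst
    · have := hc.convexOn.le_slope_of_hasDerivAt (hmem hs) (hmem ht) hst (hd s (hmem hs))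
      rw [slope_def_field, le_div_iff₀ (sub_pos.2 hst)] at this
      linarith
    · simp
    · have := hc.convexOn.slope_le_of_hasDerivAt (hmem ht) (hmem hs) hst (hd s (hmem hs))
      rw [slope_def_field, div_le_iff₀ (sub_pos.2 hst)] at this
      linarith

namespace IsSmoothCost

variable {M : ℝ} {c : ℝ → ℝ}

theorem strictMonoOn (hc : IsSmoothCost M c) : StrictMonoOn c (Icc 0 M) := by
  intro s hs t ht hst
  have := hc.tangent_le s hs t ht
  nlinarith [hc.deriv_pos s hs]

theorem continuousOn (hc : IsSmoothCost M c) : ContinuousOn c (Icc 0 M) :=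
  fun t ht => (hc.hasDerivAt t ht).continuousAt.continuousWithinAt

/-- Strong convexity of `x ↦ x * c (x + k)`. -/
theorem mul_cost_ge (hc : IsSmoothCost M c) {s t x y : ℝ} (hs : s ∈ Icc 0 M) (ht : t ∈ Icc 0 M)
    (hy : 0 ≤ y) (hxy : y - x = t - s) :
    x * c s + (y - x) * (c s + x * deriv c s) + deriv c s * (y - x) ^ 2 ≤ y * c t := by
  have := mul_le_mul_of_nonneg_left (hc.tangent_le s hs t ht) hy
  rw [← hxy] at this
  nlinarith

end IsSmoothCost

/-! ### The arc-choice functions -/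

section Choice

variable (c₁ c₂ : ℝ → ℝ) (M : ℝ)

/-- The excess of the cost of arc 2 over that of arc 1 when arc 1 carries `t`. -/
def gap (t : ℝ) : ℝ := c₂ (M - t) - c₁ t

/-- `1 + c₂'(M - t) / c₁'(t)`. -/
def damping (t : ℝ) : ℝ := 1 + deriv c₂ (M - t) / deriv c₁ t

/-- The total of `(T i - h(t))⁺`: `damping t` times what the atomic players `T` put on arc 2. -/
def activity {ι : Type} [Fintype ι] (T : ι → ℝ) (t : ℝ) : ℝ := ∑ i, max (T i - h c₁ c₂ M t) 0

/-- `damping t` times the part of the weight on arc 2 not due to the atomic players `T`. -/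
def residual {ι : Type} [Fintype ι] (T : ι → ℝ) (t : ℝ) : ℝ :=
  (M - t) * damping c₁ c₂ M t - activity c₁ c₂ M T t

/-- `b` is the largest possible equilibrium weight on arc 1. -/
structure IsCap (b : ℝ) : Prop where
  mem : b ∈ Icc 0 M
  tight : (b = M ∧ 0 < gap c₁ c₂ M b) ∨
    (gap c₁ c₂ M b = 0 ∧ (M - b) * deriv c₂ (M - b) ≤ b * deriv c₁ b)

/-- `t` is the weight on arc 1 at the composite equilibrium with atomic players `T`. -/
structure IsEqLoad (b : ℝ) {ι : Type} [Fintype ι] (T : ι → ℝ) (t : ℝ) : Prop where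
  mem : t ∈ Icc 0 b
  residual_nonneg : 0 ≤ residual c₁ c₂ M T t
  residual_eq_zero : t < b → residual c₁ c₂ M T t = 0

/-- The flow in which arc 1 carries `t` and every atomic player of `T` responds optimally. -/
def eqFlow (T₀ : ℝ) {ι : Type} [Fintype ι] (T : ι → ℝ) (t : ℝ) : Flow ι where
  nonatomic := ![T₀ - residual c₁ c₂ M T t / damping c₁ c₂ M t,
    residual c₁ c₂ M T t / damping c₁ c₂ M t]
  atomic i := ![T i - max (T i - h c₁ c₂ M t) 0 / damping c₁ c₂ M t,
    max (T i - h c₁ c₂ M t) 0 / damping c₁ c₂ M t]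

/-- The cost to the deputies of a player of weight `w` facing atomic opponents `T` when arc 1
carries `t`. -/
def loadCost {ι : Type} [Fintype ι] (T : ι → ℝ) (w t : ℝ) : ℝ :=
  w * c₁ t + gap c₁ c₂ M t * (M - t - activity c₁ c₂ M T t / damping c₁ c₂ M t)

end Choice

/-! ### Monotonicity and continuity in the load; existence and uniqueness of equilibrium loads -/

section Analysis

variable {c₁ c₂ : ℝ → ℝ} {M b : ℝ} {ι : Type} [Fintype ι]

theorem sub_mem_Icc {t : ℝ} (ht : t ∈ Icc 0 M) : M - t ∈ Icc 0 M :=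
  ⟨by linarith [ht.2], by linarith [ht.1]⟩

theorem strictAntiOn_gap (h₁ : IsSmoothCost M c₁) (h₂ : IsSmoothCost M c₂) :
    StrictAntiOn (gap c₁ c₂ M) (Icc 0 M) := by
  intro s hs t ht hst
  have e₁ := h₁.strictMonoOn hs ht hst
  have e₂ := h₂.strictMonoOn (sub_mem_Icc ht) (sub_mem_Icc hs) (by linarith)
  unfold gap
  linarith

theorem one_lt_damping (h₁ : IsSmoothCost M c₁) (h₂ : IsSmoothCost M c₂) {t : ℝ}
    (ht : t ∈ Icc 0 M) : 1 < damping c₁ c₂ M t := by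
  have := div_pos (h₂.deriv_pos _ (sub_mem_Icc ht)) (h₁.deriv_pos _ ht)
  unfold damping
  linarith

theorem damping_mul (h₁ : IsSmoothCost M c₁) {t : ℝ} (ht : t ∈ Icc 0 M) :
    damping c₁ c₂ M t * deriv c₁ t = deriv c₁ t + deriv c₂ (M - t) := by
  have := (h₁.deriv_pos _ ht).ne'
  unfold damping
  field_simp

theorem h_mul (h₁ : IsSmoothCost M c₁) {t : ℝ} (ht : t ∈ Icc 0 M) :
    h c₁ c₂ M t * deriv c₁ t = gap c₁ c₂ M t :=
  div_mul_cancel₀ _ (h₁.deriv_pos _ ht).ne'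

theorem antitoneOn_damping (h₁ : IsSmoothCost M c₁) (h₂ : IsSmoothCost M c₂) :
    AntitoneOn (damping c₁ c₂ M) (Icc 0 M) := by
  intro s hs t ht hst
  unfold damping
  gcongr
  · exact (h₂.deriv_pos _ (sub_mem_Icc hs)).le
  · exact h₁.deriv_pos _ hs
  · exact h₂.deriv_mono (sub_mem_Icc ht) (sub_mem_Icc hs) (by linarith)
  · exact h₁.deriv_mono hs ht hst

namespace IsCap

theorem gap_nonneg (hb : IsCap c₁ c₂ M b) : 0 ≤ gap c₁ c₂ M b := by
  rcases hb.tight with ⟨-, e⟩ | ⟨e, -⟩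
  exacts [e.le, e.ge]

theorem Icc_subset (hb : IsCap c₁ c₂ M b) {t : ℝ} (ht : t ∈ Icc 0 b) : t ∈ Icc 0 M :=
  ⟨ht.1, ht.2.trans hb.mem.2⟩

/-- Up to the cap the numerator of h is nonnegative and decreasing while the denominator is positive
and nondecreasing. Past a balanced cap the numerator is negative and this argument fails. -/
theorem h_strictAntiOn (hb : IsCap c₁ c₂ M b) (h₁ : IsSmoothCost M c₁) (h₂ : IsSmoothCost M c₂) :
    StrictAntiOn (h c₁ c₂ M) (Icc 0 b) := by
  intro s hs t ht hst
  have hs' := hb.Icc_subset hs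
  have ht' := hb.Icc_subset ht
  have e := strictAntiOn_gap h₁ h₂ hs' ht' hst
  have e' : 0 ≤ gap c₁ c₂ M t := hb.gap_nonneg.trans
    ((strictAntiOn_gap h₁ h₂).antitoneOn ht' hb.mem ht.2)
  change gap c₁ c₂ M t / _ < gap c₁ c₂ M s / _
  have p := h₁.deriv_pos s hs'
  calc gap c₁ c₂ M t / deriv c₁ t ≤ gap c₁ c₂ M t / deriv c₁ s := by
        gcongr
        exact h₁.deriv_mono hs' ht' hst.le
    _ < gap c₁ c₂ M s / deriv c₁ s := by gcongr

theorem h_cap_nonneg (hb : IsCap c₁ c₂ M b) (h₁ : IsSmoothCost M c₁) : 0 ≤ h c₁ c₂ M b :=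
  div_nonneg hb.gap_nonneg (h₁.deriv_pos _ hb.mem).le

theorem right_mem (hb : IsCap c₁ c₂ M b) : b ∈ Icc 0 b := ⟨hb.mem.1, le_rfl⟩

theorem h_cap_le (hb : IsCap c₁ c₂ M b) (h₁ : IsSmoothCost M c₁) (h₂ : IsSmoothCost M c₂) {t : ℝ}
    (ht : t ∈ Icc 0 b) : h c₁ c₂ M b ≤ h c₁ c₂ M t :=
  (hb.h_strictAntiOn h₁ h₂).antitoneOn ht hb.right_mem ht.2

theorem h_nonneg (hb : IsCap c₁ c₂ M b) (h₁ : IsSmoothCost M c₁) (h₂ : IsSmoothCost M c₂) {t : ℝ}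
    (ht : t ∈ Icc 0 b) : 0 ≤ h c₁ c₂ M t :=
  (hb.h_cap_nonneg h₁).trans (hb.h_cap_le h₁ h₂ ht)

theorem h_pos (hb : IsCap c₁ c₂ M b) (h₁ : IsSmoothCost M c₁) (h₂ : IsSmoothCost M c₂) {t : ℝ}
    (ht : 0 ≤ t) (htb : t < b) : 0 < h c₁ c₂ M t :=
  (hb.h_cap_nonneg h₁).trans_lt (hb.h_strictAntiOn h₁ h₂ ⟨ht, htb.le⟩ hb.right_mem htb)

theorem activity_monotoneOn (hb : IsCap c₁ c₂ M b) (h₁ : IsSmoothCost M c₁)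
    (h₂ : IsSmoothCost M c₂) (T : ι → ℝ) : MonotoneOn (activity c₁ c₂ M T) (Icc 0 b) := by
  intro s hs t ht hst
  unfold activity
  gcongr
  exact (hb.h_strictAntiOn h₁ h₂).antitoneOn hs ht hst

/-- Strictness comes from M - t, multiplied by a positive nonincreasing factor; the activity can
only help. -/
theorem residual_strictAntiOn (hb : IsCap c₁ c₂ M b) (h₁ : IsSmoothCost M c₁)
    (h₂ : IsSmoothCost M c₂) (T : ι → ℝ) : StrictAntiOn (residual c₁ c₂ M T) (Icc 0 b) := by
  intro s hs t ht hst
  have e := hb.activity_monotoneOn h₁ h₂ T hs ht hst.le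
  have e₁ := antitoneOn_damping h₁ h₂ (hb.Icc_subset hs) (hb.Icc_subset ht) hst.le
  have e₂ := one_lt_damping h₁ h₂ (hb.Icc_subset hs)
  have e₃ := (hb.Icc_subset ht).2
  unfold residual
  nlinarith

end IsCap

theorem continuousOn_deriv_sub (h₂ : IsSmoothCost M c₂) :
    ContinuousOn (fun t => deriv c₂ (M - t)) (Icc 0 M) :=
  h₂.continuousOn_deriv.comp (by fun_prop) fun _ => sub_mem_Icc

theorem continuousOn_gap (h₁ : IsSmoothCost M c₁) (h₂ : IsSmoothCost M c₂) :
    ContinuousOn (gap c₁ c₂ M) (Icc 0 M) :=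
  (h₂.continuousOn.comp (by fun_prop) fun _ => sub_mem_Icc).sub h₁.continuousOn

theorem continuousOn_h (h₁ : IsSmoothCost M c₁) (h₂ : IsSmoothCost M c₂) :
    ContinuousOn (h c₁ c₂ M) (Icc 0 M) :=
  (continuousOn_gap h₁ h₂).div h₁.continuousOn_deriv fun t ht => (h₁.deriv_pos t ht).ne'

theorem continuousOn_damping (h₁ : IsSmoothCost M c₁) (h₂ : IsSmoothCost M c₂) :
    ContinuousOn (damping c₁ c₂ M) (Icc 0 M) :=
  continuousOn_const.add
    ((continuousOn_deriv_sub h₂).div h₁.continuousOn_deriv fun t ht => (h₁.deriv_pos t ht).ne')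

theorem continuousOn_activity (h₁ : IsSmoothCost M c₁) (h₂ : IsSmoothCost M c₂) (T : ι → ℝ) :
    ContinuousOn (activity c₁ c₂ M T) (Icc 0 M) :=
  continuousOn_finsetSum _ fun _ _ =>
    (continuousOn_const.sub (continuousOn_h h₁ h₂)).sup continuousOn_const

theorem continuousOn_residual (h₁ : IsSmoothCost M c₁) (h₂ : IsSmoothCost M c₂) (T : ι → ℝ) :
    ContinuousOn (residual c₁ c₂ M T) (Icc 0 M) :=
  ((continuousOn_const.sub continuousOn_id).mul (continuousOn_damping h₁ h₂)).sub
    (continuousOn_activity h₁ h₂ T)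

theorem continuousOn_loadCost (h₁ : IsSmoothCost M c₁) (h₂ : IsSmoothCost M c₂) (T : ι → ℝ)
    (w : ℝ) : ContinuousOn (loadCost c₁ c₂ M T w) (Icc 0 M) :=
  (continuousOn_const.mul h₁.continuousOn).add
    ((continuousOn_gap h₁ h₂).mul ((continuousOn_const.sub continuousOn_id).sub
      ((continuousOn_activity h₁ h₂ T).div (continuousOn_damping h₁ h₂)
        fun _ ht => (zero_lt_one.trans (one_lt_damping h₁ h₂ ht)).ne')))

theorem activity_nonneg (T : ι → ℝ) (t : ℝ) : 0 ≤ activity c₁ c₂ M T t :=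
  Finset.sum_nonneg fun _ _ => le_max_right _ _

theorem activity_le_sum {T : ι → ℝ} (hT : ∀ i, 0 ≤ T i) {t : ℝ} (ht : 0 ≤ h c₁ c₂ M t) :
    activity c₁ c₂ M T t ≤ ∑ i, T i :=
  Finset.sum_le_sum fun i _ => max_le (by linarith) (hT i)

/-- The activity of several atomic players is at most that of a single player of the same total
weight. -/
theorem activity_le_max {T : ι → ℝ} {w : ℝ} (hT : ∀ i, 0 ≤ T i) (hw : ∑ i, T i ≤ w) {t : ℝ}
    (ht : 0 ≤ h c₁ c₂ M t) : activity c₁ c₂ M T t ≤ max (w - h c₁ c₂ M t) 0 := by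
  classical
  by_cases hi : ∃ i, h c₁ c₂ M t < T i
  -- The subtraction of h is charged to player i alone; the others are bounded by their full
  -- weights.
  · obtain ⟨i, hi⟩ := hi
    refine le_trans ?_ (le_max_left _ _)
    rw [← Finset.add_sum_erase _ _ (Finset.mem_univ i)] at hw
    unfold activity
    rw [← Finset.add_sum_erase _ _ (Finset.mem_univ i), max_eq_left (sub_nonneg.2 hi.le)]
    have : ∑ j ∈ Finset.univ.erase i, max (T j - h c₁ c₂ M t) 0 ≤ ∑ j ∈ Finset.univ.erase i, T j :=
      Finset.sum_le_sum fun j _ => max_le (by linarith) (hT j)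
    linarith
  · push Not at hi
    have : activity c₁ c₂ M T t = 0 :=
      Finset.sum_eq_zero fun i _ => max_eq_right (sub_nonpos.2 (hi i))
    rw [this]
    exact le_max_right _ _

theorem activity_eq_zero_iff {T : ι → ℝ} {t : ℝ} :
    activity c₁ c₂ M T t = 0 ↔ ∀ i, T i ≤ h c₁ c₂ M t := by
  unfold activity
  rw [Finset.sum_eq_zero_iff_of_nonneg fun _ _ => le_max_right _ _]
  simp

theorem activity_sumElim {κ : Type} [Fintype κ] (S : κ → ℝ) (T : ι → ℝ) (t : ℝ) :
    activity c₁ c₂ M (Sum.elim S T) t = activity c₁ c₂ M S t + activity c₁ c₂ M T t := by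
  simp [activity]

theorem residual_sumElim {κ : Type} [Fintype κ] (S : κ → ℝ) (T : ι → ℝ) (t : ℝ) :
    residual c₁ c₂ M (Sum.elim S T) t = residual c₁ c₂ M T t - activity c₁ c₂ M S t := by
  unfold residual
  rw [activity_sumElim]
  ring

namespace IsEqLoad

theorem unique {T : ι → ℝ} (hb : IsCap c₁ c₂ M b) (h₁ : IsSmoothCost M c₁)
    (h₂ : IsSmoothCost M c₂) {s t : ℝ} (hs : IsEqLoad c₁ c₂ M b T s)
    (ht : IsEqLoad c₁ c₂ M b T t) : s = t := by
  wlog hst : s < t generalizing s t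
  · rcases (not_lt.1 hst).eq_or_lt with e | e
    exacts [e.symm, (this ht hs e).symm]
  have e := hb.residual_strictAntiOn h₁ h₂ T hs.mem ht.mem hst
  linarith [hs.residual_eq_zero (hst.trans_le ht.mem.2), ht.residual_nonneg]

/-- Either the arcs cost the same or the nonatomic players only use arc 1. -/
theorem gap_eq_zero_or {T : ι → ℝ} (hb : IsCap c₁ c₂ M b) {t : ℝ} (ht : IsEqLoad c₁ c₂ M b T t) :
    gap c₁ c₂ M t = 0 ∨ residual c₁ c₂ M T t = 0 := by
  rcases ht.mem.2.eq_or_lt with rfl | e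
  · rcases hb.tight with ⟨rfl, -⟩ | ⟨e, -⟩
    -- With cap M the whole weight is on arc 1, so the residual is minus the activity.
    · refine Or.inr (le_antisymm ?_ ht.residual_nonneg)
      have := activity_nonneg (c₁ := c₁) (c₂ := c₂) (M := t) T t
      unfold residual
      linarith
    · exact Or.inl e
  · exact Or.inr (ht.residual_eq_zero e)

theorem gap_nonneg {T : ι → ℝ} (hb : IsCap c₁ c₂ M b) (h₁ : IsSmoothCost M c₁)
    (h₂ : IsSmoothCost M c₂) {t : ℝ} (ht : IsEqLoad c₁ c₂ M b T t) : 0 ≤ gap c₁ c₂ M t :=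
  hb.gap_nonneg.trans ((strictAntiOn_gap h₁ h₂).antitoneOn (hb.Icc_subset ht.mem) hb.mem ht.mem.2)

end IsEqLoad

/-- If the residual is still nonnegative at the cap, the cap is the load; otherwise it changes sign
on [0, b]. At 0 it is at least M - ∑ T i, since the damping exceeds 1 and the activity is at most
the total atomic weight. -/
theorem exists_isEqLoad (hb : IsCap c₁ c₂ M b) (h₁ : IsSmoothCost M c₁)
    (h₂ : IsSmoothCost M c₂) {T : ι → ℝ} (hT : ∀ i, 0 ≤ T i) (hsum : ∑ i, T i ≤ M) :
    ∃ t, IsEqLoad c₁ c₂ M b T t := by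
  by_cases hr : 0 ≤ residual c₁ c₂ M T b
  · exact ⟨b, hb.right_mem, hr, fun e => (lt_irrefl _ e).elim⟩
  have h0 : (0 : ℝ) ∈ Icc 0 b := ⟨le_rfl, hb.mem.1⟩
  have hr0 : 0 ≤ residual c₁ c₂ M T 0 := by
    have e := activity_le_sum hT (hb.h_nonneg h₁ h₂ h0)
    have e' := one_lt_damping h₁ h₂ (hb.Icc_subset h0)
    have : 0 ≤ M := hb.mem.1.trans hb.mem.2
    unfold residual
    nlinarith
  obtain ⟨t, ht, hrt⟩ := intermediate_value_Icc' hb.mem.1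
    ((continuousOn_residual h₁ h₂ T).mono fun _ => hb.Icc_subset) ⟨(not_le.1 hr).le, hr0⟩
  exact ⟨t, ht, hrt.ge, fun _ => hrt⟩

end Analysis

/-! ### Composite equilibria and equilibrium loads -/

section Equilibrium

open Filter Topology

variable {c₁ c₂ : ℝ → ℝ} {M b T₀ : ℝ} {ι : Type} [Fintype ι] {T : ι → ℝ}

theorem mem_feasible {w : ℝ} {x : Fin 2 → ℝ} :
    x ∈ feasible w ↔ 0 ≤ x 0 ∧ 0 ≤ x 1 ∧ x 0 + x 1 = w := by
  simp [feasible, Fin.forall_fin_two, and_assoc]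

theorem load_zero_add_load_one {x : Flow ι} (h₀ : x.nonatomic ∈ feasible T₀)
    (hx : ∀ i, x.atomic i ∈ feasible (T i)) : x.load 0 + x.load 1 = T₀ + ∑ i, T i := by
  have e : ∑ i, T i = ∑ i, (x.atomic i 0 + x.atomic i 1) :=
    Finset.sum_congr rfl fun i _ => (mem_feasible.1 (hx i)).2.2.symm
  rw [e, Finset.sum_add_distrib, ← (mem_feasible.1 h₀).2.2]
  unfold Flow.load
  ring

theorem atomic_le_load {x : Flow ι} (h₀ : x.nonatomic ∈ feasible T₀)
    (hx : ∀ i, x.atomic i ∈ feasible (T i)) (i : ι) (r : Fin 2) : x.atomic i r ≤ x.load r := by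
  have := Finset.single_le_sum (f := fun i => x.atomic i r) (fun j _ => (hx j).1 r)
    (Finset.mem_univ i)
  have := h₀.1 r
  unfold Flow.load
  linarith

theorem load_nonneg {x : Flow ι} (h₀ : x.nonatomic ∈ feasible T₀)
    (hx : ∀ i, x.atomic i ∈ feasible (T i)) (r : Fin 2) : 0 ≤ x.load r :=
  add_nonneg (h₀.1 r) (Finset.sum_nonneg fun i _ => (hx i).1 r)

namespace IsEqLoad

variable {t : ℝ}

/-- This ensures that T₀ suffices for the nonatomic weight placed on arc 2. The residual can be
nonzero only at a balanced cap, where h = 0; there, after multiplication by c₁', the claim reduces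
to the assumed inequality between ξ̂ c₁' and (M - ξ̂) c₂'. -/
theorem residual_le (ht : IsEqLoad c₁ c₂ M b T t) (hb : IsCap c₁ c₂ M b) (h₁ : IsSmoothCost M c₁)
    (h₂ : IsSmoothCost M c₂) (hT₀ : 0 ≤ T₀) (hT : ∀ i, 0 ≤ T i) (hM : T₀ + ∑ i, T i = M) :
    residual c₁ c₂ M T t ≤ T₀ * damping c₁ c₂ M t := by
  have hm := hb.Icc_subset ht.mem
  have hg := one_lt_damping h₁ h₂ hm
  rcases ht.gap_eq_zero_or hb with e | e
  swap
  · rw [e]; positivity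
  have hanti := strictAntiOn_gap h₁ h₂
  have hle := hanti.antitoneOn hm hb.mem ht.mem.2
  rcases hb.tight with ⟨-, hpos⟩ | ⟨e', hbal⟩
  · linarith
  obtain rfl : t = b := hanti.injOn hm hb.mem (e.trans e'.symm)
  have hz : h c₁ c₂ M t = 0 := by
    change gap c₁ c₂ M t / _ = 0
    rw [e, zero_div]
  have hact : activity c₁ c₂ M T t = ∑ i, T i :=
    Finset.sum_congr rfl fun i _ => by rw [hz, sub_zero, max_eq_left (hT i)]
  have p₁ := h₁.deriv_pos _ hm
  refine le_of_mul_le_mul_right ?_ p₁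
  unfold residual
  rw [hact, sub_mul, mul_assoc, mul_assoc, damping_mul h₁ hm]
  have p₂ := mul_nonneg hT₀ (h₂.deriv_pos _ (sub_mem_Icc hm)).le
  rw [← hM] at hbal p₂ ⊢
  linarith

theorem load_eqFlow_one (hb : IsCap c₁ c₂ M b) (h₁ : IsSmoothCost M c₁)
    (h₂ : IsSmoothCost M c₂) (ht : IsEqLoad c₁ c₂ M b T t) :
    (eqFlow c₁ c₂ M T₀ T t).load 1 = M - t := by
  have hg := (zero_lt_one.trans (one_lt_damping h₁ h₂ (hb.Icc_subset ht.mem))).ne'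
  simp only [Flow.load, eqFlow, Matrix.cons_val_one, Matrix.cons_val_fin_one, ← Finset.sum_div]
  change residual c₁ c₂ M T t / _ + activity c₁ c₂ M T t / _ = _
  unfold residual
  field_simp
  ring

theorem load_eqFlow_zero (hb : IsCap c₁ c₂ M b) (h₁ : IsSmoothCost M c₁)
    (h₂ : IsSmoothCost M c₂) (hM : T₀ + ∑ i, T i = M) (ht : IsEqLoad c₁ c₂ M b T t) :
    (eqFlow c₁ c₂ M T₀ T t).load 0 = t := by
  have e := ht.load_eqFlow_one (T₀ := T₀) hb h₁ h₂
  simp only [Flow.load, eqFlow, Matrix.cons_val_one, Matrix.cons_val_zero,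
    Finset.sum_sub_distrib] at e ⊢
  linarith

end IsEqLoad

variable [DecidableEq ι]

/-! ### First-order conditions and necessary form of a composite equilibrium -/

theorem load_deviate (x : Flow ι) (i : ι) (y : Fin 2 → ℝ) (r : Fin 2) :
    (x.deviate i y).load r = x.load r + (y r - x.atomic i r) := by
  have e : ∀ j, Function.update x.atomic i y j r
      = x.atomic j r + if j = i then y r - x.atomic i r else 0 := fun j => by
    by_cases hj : j = i
    · subst hj; simp
    · simp [hj]
  simp only [Flow.load, Flow.deviate, e, Finset.sum_add_distrib, Finset.sum_ite_eq',
    Finset.mem_univ, if_true]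
  ring

theorem atomicCost_deviate (c : Fin 2 → ℝ → ℝ) (x : Flow ι) (i : ι) (y : Fin 2 → ℝ) :
    atomicCost c (x.deviate i y) i = ∑ r, y r * c r (x.load r + (y r - x.atomic i r)) := by
  simp only [atomicCost, load_deviate]
  simp [Flow.deviate]

theorem deriv_nonneg_of_le_right {f : ℝ → ℝ} {f' δ : ℝ} (hf : HasDerivAt f f' 0) (hδ : 0 < δ)
    (hmin : ∀ t ∈ Icc 0 δ, f 0 ≤ f t) : 0 ≤ f' := by
  refine ge_of_tendsto hf.tendsto_slope_zero_right ?_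
  filter_upwards [Ioc_mem_nhdsGT hδ] with t ht
  rw [zero_add, smul_eq_mul]
  exact mul_nonneg (inv_nonneg.2 ht.1.le) (sub_nonneg.2 (hmin t ⟨ht.1.le, ht.2⟩))

/-- First-order condition: an atomic player only uses arcs of minimal marginal cost. -/
theorem IsCE.marginal_le {c : Fin 2 → ℝ → ℝ} {d : Fin 2 → ℝ} {x : Flow ι} (hx : IsCE c T₀ T x)
    (hd : ∀ r, HasDerivAt (c r) (d r) (x.load r)) {i : ι} {r s : Fin 2} (hrs : r ≠ s)
    (hr : 0 < x.atomic i r) :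
    c r (x.load r) + x.atomic i r * d r ≤ c s (x.load s) + x.atomic i s * d s := by
  have hsum : ∀ φ : Fin 2 → ℝ, ∑ q, φ q = φ r + φ s := fun φ => by
    rw [Fin.sum_univ_two]
    fin_cases r <;> fin_cases s <;> simp_all [add_comm]
  have hcases : ∀ q : Fin 2, q = r ∨ q = s := fun q => by
    fin_cases r <;> fin_cases s <;> fin_cases q <;> simp_all
  obtain ⟨hpos, htot⟩ := hx.atomic_mem i
  rw [hsum] at htot
  have h1 : HasDerivAt (fun t => (x.atomic i r - t) * c r (x.load r - t))
      (-(c r (x.load r) + x.atomic i r * d r)) 0 := by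
    have e : HasDerivAt (fun t => x.load r - t) (-1) 0 := (hasDerivAt_id 0).const_sub _
    have e' : HasDerivAt (fun t => x.atomic i r - t) (-1) 0 := (hasDerivAt_id 0).const_sub _
    have hd' : HasDerivAt (c r) (d r) (x.load r - 0) := by simpa using hd r
    have := e'.mul (hd'.comp (0 : ℝ) e)
    refine this.congr_deriv ?_
    simp
    ring
  have h2 : HasDerivAt (fun t => (x.atomic i s + t) * c s (x.load s + t))
      (c s (x.load s) + x.atomic i s * d s) 0 := by
    have e : HasDerivAt (fun t => x.load s + t) 1 0 := (hasDerivAt_id 0).const_add _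
    have e' : HasDerivAt (fun t => x.atomic i s + t) 1 0 := (hasDerivAt_id 0).const_add _
    have hd' : HasDerivAt (c s) (d s) (x.load s + 0) := by simpa using hd s
    have := e'.mul (hd'.comp (0 : ℝ) e)
    refine this.congr_deriv ?_
    simp
  -- Shifting weight t from arc r to arc s is feasible for 0 ≤ t ≤ x.atomic i r, so the resulting
  -- cost has a one-sided minimum at t = 0.
  have := deriv_nonneg_of_le_right (h1.add h2) hr fun t ht => by
    have hn := hx.nash i (fun q => if q = r then x.atomic i r - t else x.atomic i s + t) <| by
      refine ⟨fun q => ?_, ?_⟩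
      · rcases hcases q with rfl | rfl
        · simp [ht.2]
        · simp [hrs.symm, add_nonneg (hpos q) ht.1]
      · rw [hsum]
        simp [hrs.symm, htot]
    rw [atomicCost_deviate, atomicCost, hsum, hsum] at hn
    simp only [if_true, hrs.symm, if_false] at hn
    have e₁ : x.load r + (x.atomic i r - t - x.atomic i r) = x.load r - t := by ring
    have e₂ : x.load s + (x.atomic i s + t - x.atomic i s) = x.load s + t := by ring
    rw [e₁, e₂] at hn
    simpa using hn
  linarith

/-- The part of a weight `w` on arc 2 that equalizes marginal costs as far as possible. -/
theorem mul_add_eq_max {x y w k₁ k₂ d₁ d₂ : ℝ} (hx : 0 ≤ x) (hy : 0 ≤ y) (hw : x + y = w)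
    (hd₁ : 0 < d₁) (hd₂ : 0 < d₂) (hk : k₁ ≤ k₂) (hxm : 0 < x → k₁ + x * d₁ ≤ k₂ + y * d₂)
    (hym : 0 < y → k₂ + y * d₂ ≤ k₁ + x * d₁) :
    y * (d₁ + d₂) = max (w * d₁ - (k₂ - k₁)) 0 := by
  subst hw
  rcases hy.eq_or_lt with rfl | hy
  · rw [zero_mul, max_eq_right]
    rcases hx.eq_or_lt with rfl | hx
    · linarith
    · linarith [hxm hx]
  · have hym := hym hy
    have hx : 0 < x := by
      by_contra hx'
      obtain rfl : x = 0 := le_antisymm (not_lt.1 hx') hx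
      nlinarith
    have hxm := hxm hx
    rw [max_eq_left] <;> nlinarith

theorem max_sub_h_mul (h₁ : IsSmoothCost M c₁) {t : ℝ} (ht : t ∈ Icc 0 M) (w : ℝ) :
    max (w - h c₁ c₂ M t) 0 * deriv c₁ t = max (w * deriv c₁ t - gap c₁ c₂ M t) 0 := by
  rw [max_mul_of_nonneg _ _ (h₁.deriv_pos t ht).le, sub_mul, h_mul h₁ ht, zero_mul]

namespace IsCE

variable {x : Flow ι}

theorem load_one (hx : IsCE ![c₁, c₂] T₀ T x) (hM : T₀ + ∑ i, T i = M) :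
    x.load 1 = M - x.load 0 := by
  rw [← hM, ← load_zero_add_load_one hx.nonatomic_mem hx.atomic_mem]
  ring

theorem load_mem (hx : IsCE ![c₁, c₂] T₀ T x) (hM : T₀ + ∑ i, T i = M) :
    x.load 0 ∈ Icc 0 M := by
  refine ⟨load_nonneg hx.nonatomic_mem hx.atomic_mem 0, ?_⟩
  have := load_nonneg hx.nonatomic_mem hx.atomic_mem 1
  rw [hx.load_one hM] at this
  linarith

theorem marginal_zero_le (hx : IsCE ![c₁, c₂] T₀ T x) (h₁ : IsSmoothCost M c₁)
    (h₂ : IsSmoothCost M c₂) (hM : T₀ + ∑ i, T i = M) {i : ι} (hi : 0 < x.atomic i 0) :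
    c₁ (x.load 0) + x.atomic i 0 * deriv c₁ (x.load 0) ≤
      c₂ (M - x.load 0) + x.atomic i 1 * deriv c₂ (M - x.load 0) := by
  have := hx.marginal_le (d := ![deriv c₁ (x.load 0), deriv c₂ (M - x.load 0)])
    (Fin.forall_fin_two.2 ⟨h₁.hasDerivAt _ (hx.load_mem hM), by
      rw [hx.load_one hM]; exact h₂.hasDerivAt _ (sub_mem_Icc (hx.load_mem hM))⟩)
    (zero_ne_one) hi
  simpa [hx.load_one hM] using this

theorem marginal_one_le (hx : IsCE ![c₁, c₂] T₀ T x) (h₁ : IsSmoothCost M c₁)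
    (h₂ : IsSmoothCost M c₂) (hM : T₀ + ∑ i, T i = M) {i : ι} (hi : 0 < x.atomic i 1) :
    c₂ (M - x.load 0) + x.atomic i 1 * deriv c₂ (M - x.load 0) ≤
      c₁ (x.load 0) + x.atomic i 0 * deriv c₁ (x.load 0) := by
  have := hx.marginal_le (d := ![deriv c₁ (x.load 0), deriv c₂ (M - x.load 0)])
    (Fin.forall_fin_two.2 ⟨h₁.hasDerivAt _ (hx.load_mem hM), by
      rw [hx.load_one hM]; exact h₂.hasDerivAt _ (sub_mem_Icc (hx.load_mem hM))⟩)
    (one_ne_zero) hi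
  simpa [hx.load_one hM] using this

/-- Beyond a balanced cap arc 2 would be strictly cheaper, so no nonatomic player uses arc 1.
Summing the atomic first-order conditions gives t c₁'(t) ≤ (M - t) c₂'(M - t), which contradicts the
reverse inequality at the cap because the left side has strictly increased and the right side has
not increased. -/
theorem load_le_cap (hx : IsCE ![c₁, c₂] T₀ T x) (hb : IsCap c₁ c₂ M b) (h₁ : IsSmoothCost M c₁)
    (h₂ : IsSmoothCost M c₂) (hM : T₀ + ∑ i, T i = M) : x.load 0 ≤ b := by
  by_contra! hlt
  have hm := hx.load_mem hM
  have hgap := strictAntiOn_gap h₁ h₂ hb.mem hm hlt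
  rcases hb.tight with ⟨rfl, -⟩ | ⟨e, hbal⟩
  · exact hlt.not_ge hm.2
  rw [e] at hgap
  have hcost : c₂ (M - x.load 0) < c₁ (x.load 0) := by unfold gap at hgap; linarith
  have p₁ := h₁.deriv_pos _ hm
  have p₂ := h₂.deriv_pos _ (sub_mem_Icc hm)
  have hn : x.nonatomic 0 = 0 := by
    refine le_antisymm (not_lt.1 fun hpos => ?_) (hx.nonatomic_mem.1 0)
    have := hx.wardrop 0 hpos 1
    simp only [hx.load_one hM, Matrix.cons_val_zero, Matrix.cons_val_one] at this
    linarith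
  have hi : ∀ i, x.atomic i 0 * deriv c₁ (x.load 0) ≤ x.atomic i 1 * deriv c₂ (M - x.load 0) := by
    intro i
    rcases ((hx.atomic_mem i).1 0).eq_or_lt with hz | hpos
    · rw [← hz, zero_mul]
      exact mul_nonneg ((hx.atomic_mem i).1 1) p₂.le
    · linarith [hx.marginal_zero_le h₁ h₂ hM hpos]
  have hs := Finset.sum_le_sum fun i (_ : i ∈ Finset.univ) => hi i
  rw [← Finset.sum_mul, ← Finset.sum_mul] at hs
  have l₀ : x.load 0 = ∑ i, x.atomic i 0 := by unfold Flow.load; rw [hn, zero_add]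
  have l₁ : ∑ i, x.atomic i 1 ≤ M - x.load 0 := by
    rw [← hx.load_one hM]
    unfold Flow.load
    linarith [hx.nonatomic_mem.1 1]
  rw [← l₀] at hs
  have a₁ : b * deriv c₁ b < x.load 0 * deriv c₁ (x.load 0) :=
    (mul_le_mul_of_nonneg_left (h₁.deriv_mono hb.mem hm hlt.le) hb.mem.1).trans_lt
      (mul_lt_mul_of_pos_right hlt p₁)
  have a₂ : (M - x.load 0) * deriv c₂ (M - x.load 0) ≤ (M - b) * deriv c₂ (M - b) :=
    mul_le_mul (by linarith)
      (h₂.deriv_mono (sub_mem_Icc hm) (sub_mem_Icc hb.mem) (by linarith)) p₂.le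
      (by linarith [hb.mem.2])
  have a₃ := mul_le_mul_of_nonneg_right l₁ p₂.le
  linarith

theorem atomic_one (hx : IsCE ![c₁, c₂] T₀ T x) (hb : IsCap c₁ c₂ M b) (h₁ : IsSmoothCost M c₁)
    (h₂ : IsSmoothCost M c₂) (hM : T₀ + ∑ i, T i = M) (i : ι) :
    x.atomic i 1 =
      max (T i - h c₁ c₂ M (x.load 0)) 0 / damping c₁ c₂ M (x.load 0) := by
  have hm := hx.load_mem hM
  have hgap := hb.gap_nonneg.trans
    ((strictAntiOn_gap h₁ h₂).antitoneOn hm hb.mem (hx.load_le_cap hb h₁ h₂ hM))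
  obtain ⟨f₀, f₁, f₂⟩ := mem_feasible.1 (hx.atomic_mem i)
  have p₁ := h₁.deriv_pos _ hm
  have := mul_add_eq_max f₀ f₁ f₂ p₁ (h₂.deriv_pos _ (sub_mem_Icc hm)) (sub_nonneg.1 hgap)
    (hx.marginal_zero_le h₁ h₂ hM) (hx.marginal_one_le h₁ h₂ hM)
  rw [eq_div_iff (zero_lt_one.trans (one_lt_damping h₁ h₂ hm)).ne']
  refine mul_right_cancel₀ p₁.ne' ?_
  rw [max_sub_h_mul h₁ hm, mul_assoc, damping_mul h₁ hm]
  exact this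

theorem nonatomic_one (hx : IsCE ![c₁, c₂] T₀ T x) (hb : IsCap c₁ c₂ M b)
    (h₁ : IsSmoothCost M c₁) (h₂ : IsSmoothCost M c₂) (hM : T₀ + ∑ i, T i = M) :
    x.nonatomic 1 = residual c₁ c₂ M T (x.load 0) / damping c₁ c₂ M (x.load 0) := by
  have hg := (zero_lt_one.trans (one_lt_damping h₁ h₂ (hx.load_mem hM))).ne'
  have e := hx.load_one hM
  unfold Flow.load at e
  rw [Finset.sum_congr rfl fun i _ => hx.atomic_one hb h₁ h₂ hM i, ← Finset.sum_div] at e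
  change _ + activity c₁ c₂ M T (x.load 0) / _ = M - x.load 0 at e
  rw [eq_div_iff hg]
  unfold residual
  rw [← e]
  field_simp
  ring

/-- Below the cap the gap is strictly positive, so the Wardrop condition keeps nonatomic players off
arc 2; this is the vanishing of the residual. -/
theorem isEqLoad (hx : IsCE ![c₁, c₂] T₀ T x) (hb : IsCap c₁ c₂ M b) (h₁ : IsSmoothCost M c₁)
    (h₂ : IsSmoothCost M c₂) (hM : T₀ + ∑ i, T i = M) :
    IsEqLoad c₁ c₂ M b T (x.load 0) := by
  have hm := hx.load_mem hM
  have hg := zero_lt_one.trans (one_lt_damping h₁ h₂ hm)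
  have hn := (eq_div_iff hg.ne').1 (hx.nonatomic_one hb h₁ h₂ hM)
  have hn1 := hx.nonatomic_mem.1 1
  refine ⟨⟨hm.1, hx.load_le_cap hb h₁ h₂ hM⟩, ?_, fun hlt => ?_⟩
  · rw [← hn]
    exact mul_nonneg hn1 hg.le
  · have hgap := hb.gap_nonneg.trans_lt (strictAntiOn_gap h₁ h₂ hm hb.mem hlt)
    have : x.nonatomic 1 = 0 := by
      refine le_antisymm (not_lt.1 fun hpos => ?_) hn1
      have := hx.wardrop 1 hpos 0
      simp only [hx.load_one hM, Matrix.cons_val_zero, Matrix.cons_val_one] at this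
      unfold gap at hgap
      linarith
    rw [← hn, this, zero_mul]

theorem eq_eqFlow (hx : IsCE ![c₁, c₂] T₀ T x) (hb : IsCap c₁ c₂ M b) (h₁ : IsSmoothCost M c₁)
    (h₂ : IsSmoothCost M c₂) (hM : T₀ + ∑ i, T i = M) :
    x = eqFlow c₁ c₂ M T₀ T (x.load 0) := by
  have hn := hx.nonatomic_one hb h₁ h₂ hM
  have ha := hx.atomic_one hb h₁ h₂ hM
  refine Flow.ext (funext (Fin.forall_fin_two.2 ⟨?_, hn⟩))
    (funext fun i => funext (Fin.forall_fin_two.2 ⟨?_, ha i⟩))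
  · have := (mem_feasible.1 hx.nonatomic_mem).2.2
    simp only [eqFlow, Matrix.cons_val_zero]
    rw [← hn]
    linarith
  · have := (mem_feasible.1 (hx.atomic_mem i)).2.2
    simp only [eqFlow, Matrix.cons_val_zero]
    rw [← ha i]
    linarith

end IsCE

/-! ### From equilibrium loads back to composite equilibria -/

namespace IsEqLoad

variable {t : ℝ}

theorem isCE (ht : IsEqLoad c₁ c₂ M b T t) (hb : IsCap c₁ c₂ M b) (h₁ : IsSmoothCost M c₁)
    (h₂ : IsSmoothCost M c₂) (hT₀ : 0 ≤ T₀) (hT : ∀ i, 0 ≤ T i) (hM : T₀ + ∑ i, T i = M) :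
    IsCE ![c₁, c₂] T₀ T (eqFlow c₁ c₂ M T₀ T t) := by
  have hm := hb.Icc_subset ht.mem
  have hg := one_lt_damping h₁ h₂ hm
  have hg0 := zero_lt_one.trans hg
  have hgap := ht.gap_nonneg hb h₁ h₂
  have hn₀ : (eqFlow c₁ c₂ M T₀ T t).nonatomic ∈ feasible T₀ := by
    refine mem_feasible.2 ⟨?_, div_nonneg ht.residual_nonneg hg0.le, ?_⟩
    · exact sub_nonneg.2 ((div_le_iff₀ hg0).2 (ht.residual_le hb h₁ h₂ hT₀ hT hM))
    · simp [eqFlow]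
  have hat : ∀ i, (eqFlow c₁ c₂ M T₀ T t).atomic i ∈ feasible (T i) := by
    refine fun i => mem_feasible.2 ⟨?_, div_nonneg (le_max_right _ _) hg0.le, ?_⟩
    · refine sub_nonneg.2 ((div_le_iff₀ hg0).2 (max_le ?_ ?_))
      · nlinarith [hT i, hb.h_nonneg h₁ h₂ ht.mem]
      · exact mul_nonneg (hT i) hg0.le
    · simp [eqFlow]
  have l₀ := ht.load_eqFlow_zero hb h₁ h₂ hM
  have l₁ := ht.load_eqFlow_one (T₀ := T₀) hb h₁ h₂
  refine ⟨hn₀, hat, fun r hr s => ?_, fun i y hy => ?_⟩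
  · have key : c₁ t ≤ c₂ (M - t) ∧
        (0 < (eqFlow c₁ c₂ M T₀ T t).nonatomic 1 → c₂ (M - t) ≤ c₁ t) := by
      refine ⟨sub_nonneg.1 hgap, fun hpos => ?_⟩
      rcases ht.gap_eq_zero_or hb with e | e
      · exact (sub_eq_zero.1 e).le
      · simp [eqFlow, e] at hpos
    fin_cases r <;> fin_cases s <;> simp [l₀, l₁] at hr ⊢
    exacts [key.1, key.2 hr]
  · have p₁ := h₁.deriv_pos _ hm
    have p₂ := h₂.deriv_pos _ (sub_mem_Icc hm)
    have m₀ := atomic_le_load hn₀ hat i 0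
    have m₁ := atomic_le_load hn₀ hat i 1
    rw [atomicCost_deviate, atomicCost, Fin.sum_univ_two, Fin.sum_univ_two]
    simp only [l₀, l₁, Matrix.cons_val_zero, Matrix.cons_val_one] at m₀ m₁ ⊢
    obtain ⟨y₀, y₁, hyw⟩ := mem_feasible.1 hy
    obtain ⟨x₀, x₁, hxw⟩ := mem_feasible.1 (hat i)
    have hopt : (eqFlow c₁ c₂ M T₀ T t).atomic i 1 * (deriv c₁ t + deriv c₂ (M - t)) =
        max (T i * deriv c₁ t - gap c₁ c₂ M t) 0 := by
      rw [← damping_mul h₁ hm, ← max_sub_h_mul h₁ hm, ← mul_assoc]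
      congr 1
      exact div_mul_cancel₀ _ hg0.ne'
    set u := (eqFlow c₁ c₂ M T₀ T t).atomic i 0
    set v := (eqFlow c₁ c₂ M T₀ T t).atomic i 1
    have k₁ := h₁.mul_cost_ge hm (t := t + (y 0 - u)) ⟨by linarith, by linarith⟩ y₀
      (show y 0 - u = _ by ring)
    have k₂ := h₂.mul_cost_ge (sub_mem_Icc hm) (t := M - t + (y 1 - v))
      ⟨by linarith, by linarith⟩ y₁ (show y 1 - v = _ by ring)
    have hv : y 1 - v = -(y 0 - u) := by linarith
    rw [hv] at k₂
    -- The variational inequality at the proposed response: either all of T i is on arc 1, so that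
    -- any deviation lowers u, or the marginal costs agree. Convexity, in `k₁` and `k₂`, makes this
    -- sufficient for optimality.
    have hfoc : 0 ≤ (y 0 - u) * ((c₁ t + u * deriv c₁ t) - (c₂ (M - t) + v * deriv c₂ (M - t))) := by
      unfold gap at hopt
      rcases le_total (T i * deriv c₁ t - (c₂ (M - t) - c₁ t)) 0 with hle | hle
      · rw [max_eq_right hle] at hopt
        have hv0 : v = 0 := (mul_eq_zero.1 hopt).resolve_right (by positivity)
        have hu : u = T i := by linarith
        refine mul_nonneg_of_nonpos_of_nonpos (by linarith) ?_
        rw [hv0, hu]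
        linarith
      · rw [max_eq_left hle] at hopt
        rw [← hxw] at hopt
        have : (c₁ t + u * deriv c₁ t) - (c₂ (M - t) + v * deriv c₂ (M - t)) = 0 := by linarith
        rw [this, mul_zero]
    rw [hv]
    nlinarith [mul_nonneg p₁.le (sq_nonneg (y 0 - u)), mul_nonneg p₂.le (sq_nonneg (-(y 0 - u)))]

end IsEqLoad

theorem existsUnique_isCE (hb : IsCap c₁ c₂ M b) (h₁ : IsSmoothCost M c₁)
    (h₂ : IsSmoothCost M c₂) (hT₀ : 0 ≤ T₀) (hT : ∀ i, 0 ≤ T i) (hM : T₀ + ∑ i, T i = M) :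
    ∃! x, IsCE ![c₁, c₂] T₀ T x := by
  obtain ⟨t, ht⟩ := exists_isEqLoad hb h₁ h₂ hT (by linarith)
  refine ⟨_, ht.isCE hb h₁ h₂ hT₀ hT hM, fun x hx => ?_⟩
  rw [hx.eq_eqFlow hb h₁ h₂ hM, (hx.isEqLoad hb h₁ h₂ hM).unique hb h₁ h₂ ht]

end Equilibrium

/-! ### Decentralization strategies and their costs -/

namespace Strategy

variable {w : ℝ}

theorem sum_atomic_le (α : Strategy w) : ∑ i, α.atomic i ≤ w := by
  linarith [α.total, α.nonatomic_nonneg]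

theorem atomic_le (α : Strategy w) (i : Fin α.n) : α.atomic i ≤ w :=
  (Finset.single_le_sum (f := α.atomic) (fun j _ => (α.atomic_pos j).le)
    (Finset.mem_univ i)).trans α.sum_atomic_le

theorem singleAtomic_zero (hw : 0 ≤ w) :
    singleAtomic ⟨0, le_rfl, hw⟩ = allNonatomic hw :=
  dif_neg (lt_irrefl _)

theorem singleAtomic_self (hw : 0 < w) :
    singleAtomic ⟨w, hw.le, le_rfl⟩ = trivial hw :=
  dif_pos hw

/-- A strategy whose atomic deputies are together as active as the undivided player is trivial. -/
theorem eq_trivial (hw : 0 < w) (α : Strategy w) {k : ℝ} (hk : 0 < k) (hkw : k < w)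
    (hα : ∑ i, max (α.atomic i - k) 0 = w - k) : α = trivial hw := by
  obtain ⟨i, -, hi⟩ : ∃ i ∈ Finset.univ, 0 < max (α.atomic i - k) 0 :=
    Finset.exists_lt_of_sum_lt (by rw [hα]; simpa using hkw)
  have hik : 0 < α.atomic i - k := (lt_max_iff.1 hi).resolve_right (lt_irrefl _)
  have htot := α.total
  -- Subtracting k costs every further deputy something, and nonatomic weight is not counted at all.
  -- Hence the sum w - k forces deputy i to be alone with the whole weight.
  have hlt : ∀ j, max (α.atomic j - k) 0 < α.atomic j := fun j =>
    max_lt (by linarith) (α.atomic_pos j)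
  rw [← Finset.add_sum_erase _ _ (Finset.mem_univ i)] at hα htot
  rw [max_eq_left hik.le] at hα
  have hle := Finset.sum_le_sum fun j (_ : j ∈ Finset.univ.erase i) => (hlt j).le
  have hnn := α.nonatomic_nonneg
  have hempty : Finset.univ.erase i = ∅ := by
    by_contra hne
    have := Finset.sum_lt_sum_of_nonempty (Finset.nonempty_iff_ne_empty.2 hne) fun j _ => hlt j
    linarith
  rw [hempty, Finset.sum_empty] at htot hα
  have hn : α.n = 1 := by
    have := Finset.card_erase_of_mem (Finset.mem_univ i)
    rw [hempty, Finset.card_empty, Finset.card_univ, Fintype.card_fin] at this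
    have := i.pos
    omega
  obtain ⟨n, a₀, a, p₀, p, q, r⟩ := α
  subst hn
  ext1
  · rfl
  · change a₀ = w - w
    simp only at hα
    linarith
  · refine heq_of_eq (funext fun j => ?_)
    rw [Subsingleton.elim j i]
    change a i = w
    simp only at hα
    linarith

end Strategy

section Cost

variable {c₁ c₂ : ℝ → ℝ} {M b T₀ w : ℝ} {m : ℕ} {T : Fin m → ℝ}

/-- The sign of h matters only when s = 0: there is then no deputy, and the positive part must
vanish. -/
theorem activity_singleAtomic {t : ℝ} (ht : 0 ≤ h c₁ c₂ M t) (s : Icc (0 : ℝ) w) :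
    activity c₁ c₂ M (Strategy.singleAtomic s).atomic t = max ((s : ℝ) - h c₁ c₂ M t) 0 := by
  by_cases hs : 0 < (s : ℝ)
  · have e : Strategy.singleAtomic s = Strategy.oneAtomic s hs s.2.2 := dif_pos hs
    rw [e]
    exact Fin.sum_univ_one fun _ => max ((s : ℝ) - h c₁ c₂ M t) 0
  · have e : Strategy.singleAtomic s = Strategy.allNonatomic (s.2.1.trans s.2.2) := dif_neg hs
    rw [e, max_eq_right (by linarith)]
    exact Fin.sum_univ_zero fun i : Fin 0 => max (i.elim0 - h c₁ c₂ M t) 0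

theorem sumElim_nonneg (hT : ∀ j, 0 < T j) (α : Strategy w) (i : Fin α.n ⊕ Fin m) :
    0 ≤ Sum.elim α.atomic T i := by
  rcases i with i | j
  exacts [(α.atomic_pos i).le, (hT j).le]

theorem total_sumElim (hM : T₀ + ∑ j, T j + w = M) (α : Strategy w) :
    α.nonatomic + T₀ + ∑ i, Sum.elim α.atomic T i = M := by
  simp only [Fintype.sum_sum_type, Sum.elim_inl, Sum.elim_inr]
  linarith [α.total]

theorem exists_isEqLoad_strategy (hb : IsCap c₁ c₂ M b) (h₁ : IsSmoothCost M c₁)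
    (h₂ : IsSmoothCost M c₂) (hT₀ : 0 ≤ T₀) (hT : ∀ j, 0 < T j) (hM : T₀ + ∑ j, T j + w = M)
    (α : Strategy w) : ∃ t, IsEqLoad c₁ c₂ M b (Sum.elim α.atomic T) t :=
  exists_isEqLoad hb h₁ h₂ (sumElim_nonneg hT α)
    (by linarith [total_sumElim hM α, α.nonatomic_nonneg])

/-- The division of the nonatomic flow between deputies and opponents is immaterial: either both
arcs cost the same, or no nonatomic weight is on arc 2. In the second case the vanishing residual
expresses the deputies' activity through t and the opponents' activity. -/
theorem isInducedCost_iff (hb : IsCap c₁ c₂ M b) (h₁ : IsSmoothCost M c₁)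
    (h₂ : IsSmoothCost M c₂) (hT₀ : 0 ≤ T₀) (hT : ∀ j, 0 < T j) (hM : T₀ + ∑ j, T j + w = M)
    (α : Strategy w) {t : ℝ} (ht : IsEqLoad c₁ c₂ M b (Sum.elim α.atomic T) t) (u : ℝ) :
    IsInducedCost ![c₁, c₂] T₀ T α u ↔ u = loadCost c₁ c₂ M T w t := by
  have hM' := total_sumElim hM α
  have hce := ht.isCE hb h₁ h₂ (add_nonneg α.nonatomic_nonneg hT₀) (sumElim_nonneg hT α) hM'
  have l₀ := ht.load_eqFlow_zero hb h₁ h₂ hM'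
  have l₁ := ht.load_eqFlow_one (T₀ := α.nonatomic + T₀) hb h₁ h₂
  have hg := (zero_lt_one.trans (one_lt_damping h₁ h₂ (hb.Icc_subset ht.mem))).ne'
  have key : ∀ x₀ : Fin 2 → ℝ, x₀ ∈ feasible α.nonatomic →
      (fun r => (eqFlow c₁ c₂ M (α.nonatomic + T₀) (Sum.elim α.atomic T) t).nonatomic r - x₀ r)
        ∈ feasible T₀ →
      ∑ r, (x₀ r + ∑ i,
          (eqFlow c₁ c₂ M (α.nonatomic + T₀) (Sum.elim α.atomic T) t).atomic (Sum.inl i) r) *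
        (![c₁, c₂] : Fin 2 → ℝ → ℝ) r
          ((eqFlow c₁ c₂ M (α.nonatomic + T₀) (Sum.elim α.atomic T) t).load r)
        = loadCost c₁ c₂ M T w t := by
    intro x₀ hx₀ hx₀'
    obtain ⟨f₀, f₁, f₂⟩ := mem_feasible.1 hx₀
    have f₃ := (mem_feasible.1 hx₀').2.1
    have htot := α.total
    rw [Fin.sum_univ_two, l₀, l₁]
    simp only [eqFlow, Sum.elim_inl, Matrix.cons_val_zero, Matrix.cons_val_one,
      Matrix.cons_val_fin_one, Finset.sum_sub_distrib, ← Finset.sum_div] at f₃ ⊢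
    change (x₀ 0 + (∑ i, α.atomic i - activity c₁ c₂ M α.atomic t / damping c₁ c₂ M t)) * c₁ t +
      (x₀ 1 + activity c₁ c₂ M α.atomic t / damping c₁ c₂ M t) * c₂ (M - t) = _
    have e : (x₀ 0 + (∑ i, α.atomic i - activity c₁ c₂ M α.atomic t / damping c₁ c₂ M t)) * c₁ t +
        (x₀ 1 + activity c₁ c₂ M α.atomic t / damping c₁ c₂ M t) * c₂ (M - t) =
        w * c₁ t +
          gap c₁ c₂ M t * (x₀ 1 + activity c₁ c₂ M α.atomic t / damping c₁ c₂ M t) := by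
      have ew : w * c₁ t = (x₀ 0 + x₀ 1 + ∑ i, α.atomic i) * c₁ t := by rw [f₂, htot]
      rw [ew, gap]
      ring
    rw [e]
    unfold loadCost
    rcases ht.gap_eq_zero_or hb with e | e
    · rw [e, zero_mul, zero_mul]
    · rw [e, zero_div] at f₃
      have : x₀ 1 = 0 := by linarith
      rw [residual_sumElim, residual] at e
      rw [this, zero_add]
      congr 2
      field_simp
      linarith
  constructor
  · rintro ⟨z, x₀, hz, hx₀, hx₀', rfl⟩
    have hzt := (hz.isEqLoad hb h₁ h₂ hM').unique hb h₁ h₂ ht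
    have hz' := hz.eq_eqFlow hb h₁ h₂ hM'
    rw [hzt] at hz'
    subst hz'
    exact key x₀ hx₀ hx₀'
  · rintro rfl
    obtain ⟨z₀, z₁, z₂⟩ := mem_feasible.1 hce.nonatomic_mem
    set z := eqFlow c₁ c₂ M (α.nonatomic + T₀) (Sum.elim α.atomic T) t
    have hp := α.nonatomic_nonneg
    -- An admissible division of the nonatomic flow: the deputies fill arc 1 first.
    let a := min (z.nonatomic 0) α.nonatomic
    have ha₀ : a ≤ z.nonatomic 0 := min_le_left _ _
    have ha₁ : a ≤ α.nonatomic := min_le_right _ _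
    have ha₂ : α.nonatomic - a ≤ z.nonatomic 1 := by
      rcases min_choice (z.nonatomic 0) α.nonatomic with e | e <;> change a = _ at e <;>
        rw [e] <;> linarith
    have hx₀ : ![a, α.nonatomic - a] ∈ feasible α.nonatomic :=
      mem_feasible.2 ⟨le_min z₀ hp, sub_nonneg.2 ha₁, by simp⟩
    have hx₀' : (fun r => z.nonatomic r - (![a, α.nonatomic - a] : Fin 2 → ℝ) r) ∈ feasible T₀ :=
      mem_feasible.2 ⟨sub_nonneg.2 ha₀, sub_nonneg.2 ha₂, by simp; linarith⟩
    exact ⟨z, _, hce, hx₀, hx₀', (key _ hx₀ hx₀').symm⟩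

theorem inducedCost_eq (hb : IsCap c₁ c₂ M b) (h₁ : IsSmoothCost M c₁)
    (h₂ : IsSmoothCost M c₂) (hT₀ : 0 ≤ T₀) (hT : ∀ j, 0 < T j) (hM : T₀ + ∑ j, T j + w = M)
    (α : Strategy w) {t : ℝ} (ht : IsEqLoad c₁ c₂ M b (Sum.elim α.atomic T) t) :
    inducedCost ![c₁, c₂] T₀ T α = loadCost c₁ c₂ M T w t :=
  (isInducedCost_iff hb h₁ h₂ hT₀ hT hM α ht _).1 (Classical.epsilon_spec
    ⟨_, (isInducedCost_iff hb h₁ h₂ hT₀ hT hM α ht _).2 rfl⟩)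

/-- If all strategies induce the same load, they are all optimal and equivalent. -/
theorem isOptimal_of_forall_isEqLoad (hb : IsCap c₁ c₂ M b) (h₁ : IsSmoothCost M c₁)
    (h₂ : IsSmoothCost M c₂) (hT₀ : 0 ≤ T₀) (hT : ∀ j, 0 < T j) (hM : T₀ + ∑ j, T j + w = M)
    {t : ℝ} (ht : ∀ α : Strategy w, IsEqLoad c₁ c₂ M b (Sum.elim α.atomic T) t)
    (α β : Strategy w) :
    IsOptimal ![c₁, c₂] T₀ T α ∧ AreEquivalent ![c₁, c₂] T₀ T α β := by
  have e := fun γ : Strategy w => inducedCost_eq hb h₁ h₂ hT₀ hT hM γ (ht γ)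
  exact ⟨fun γ => by rw [e, e], by rw [AreEquivalent, e, e]⟩

/-- Every strategy has the same equilibrium load as some single-atomic one. -/
theorem exists_singleAtomic_isEqLoad (hb : IsCap c₁ c₂ M b) (h₁ : IsSmoothCost M c₁)
    (h₂ : IsSmoothCost M c₂) (hw : 0 ≤ w) (α : Strategy w) {t : ℝ}
    (ht : IsEqLoad c₁ c₂ M b (Sum.elim α.atomic T) t) :
    ∃ s : Icc (0 : ℝ) w,
      IsEqLoad c₁ c₂ M b (Sum.elim (Strategy.singleAtomic s).atomic T) t := by
  have hnn := hb.h_nonneg h₁ h₂ ht.mem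
  suffices ∃ s : Icc (0 : ℝ) w,
      max ((s : ℝ) - h c₁ c₂ M t) 0 = activity c₁ c₂ M α.atomic t by
    obtain ⟨s, hs⟩ := this
    rw [← activity_singleAtomic hnn] at hs
    refine ⟨s, ht.mem, ?_, ?_⟩ <;> rw [residual_sumElim, hs, ← residual_sumElim]
    exacts [ht.residual_nonneg, ht.residual_eq_zero]
  have hact := activity_le_max (c₁ := c₁) (c₂ := c₂) (M := M) (t := t)
    (fun i => (α.atomic_pos i).le) α.sum_atomic_le hnn
  rcases (activity_nonneg (c₁ := c₁) (c₂ := c₂) (M := M) α.atomic t).eq_or_lt with e | e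
  · exact ⟨⟨0, le_rfl, hw⟩, by rw [← e]; exact max_eq_right (by simpa using hnn)⟩
  · have hle : activity c₁ c₂ M α.atomic t ≤ w - h c₁ c₂ M t := by
      rcases le_max_iff.1 hact with e' | e'
      exacts [e', (e'.not_gt e).elim]
    -- The deputy weight whose activity at t is the prescribed one; `activity_le_max` keeps it at
    -- most w.
    refine ⟨⟨h c₁ c₂ M t + activity c₁ c₂ M α.atomic t, by positivity, by linarith⟩, ?_⟩
    simp [e.le]

/-- For fixed x the residual at x is continuous in s, so a strict sign persists near s₀. By
monotonicity of the residual in the load, that sign tells on which side of x the load L s lies. -/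
theorem continuous_load_singleAtomic (hb : IsCap c₁ c₂ M b) (h₁ : IsSmoothCost M c₁)
    (h₂ : IsSmoothCost M c₂) {L : Icc (0 : ℝ) w → ℝ}
    (hL : ∀ s, IsEqLoad c₁ c₂ M b (Sum.elim (Strategy.singleAtomic s).atomic T) (L s)) :
    Continuous L := by
  have hr : ∀ {x}, x ∈ Icc 0 b → ∀ s : Icc (0 : ℝ) w,
      residual c₁ c₂ M (Sum.elim (Strategy.singleAtomic s).atomic T) x =
        residual c₁ c₂ M T x - max ((s : ℝ) - h c₁ c₂ M x) 0 := fun hx s => by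
    rw [residual_sumElim, activity_singleAtomic (hb.h_nonneg h₁ h₂ hx)]
  have hanti := fun s : Icc (0 : ℝ) w =>
    hb.residual_strictAntiOn h₁ h₂ (Sum.elim (Strategy.singleAtomic s).atomic T)
  have hc : ∀ x, Continuous fun s : Icc (0 : ℝ) w =>
      residual c₁ c₂ M T x - max ((s : ℝ) - h c₁ c₂ M x) 0 := fun x => by fun_prop
  refine continuous_iff_continuousAt.2 fun s₀ => tendsto_order.2 ⟨fun x hx => ?_, fun x hx => ?_⟩
  · rcases lt_or_ge x 0 with h0 | h0
    · exact Filter.Eventually.of_forall fun s => h0.trans_le (hL s).mem.1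
    have hxb : x ∈ Icc 0 b := ⟨h0, hx.le.trans (hL s₀).mem.2⟩
    have hpos := (hL s₀).residual_nonneg.trans_lt (hanti s₀ hxb (hL s₀).mem hx)
    rw [hr hxb] at hpos
    filter_upwards [(hc x).continuousAt.eventually_const_lt hpos] with s hs
    rw [← hr hxb] at hs
    by_contra! hle
    have h' := (hanti s).antitoneOn (hL s).mem hxb hle
    rcases hle.eq_or_lt with e | e
    · have := (hL s).residual_eq_zero (e ▸ hx.trans_le (hL s₀).mem.2)
      linarith
    · have := (hL s).residual_eq_zero (e.trans_le hxb.2)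
      linarith
  · rcases lt_or_ge b x with h0 | h0
    · exact Filter.Eventually.of_forall fun s => (hL s).mem.2.trans_lt h0
    have hxb : x ∈ Icc 0 b := ⟨(hL s₀).mem.1.trans hx.le, h0⟩
    have hneg := hanti s₀ (hL s₀).mem hxb hx
    rw [(hL s₀).residual_eq_zero (hx.trans_le h0), hr hxb] at hneg
    filter_upwards [(hc x).continuousAt.eventually_lt_const hneg] with s hs
    rw [← hr hxb] at hs
    by_contra! hle
    have h' := (hanti s).antitoneOn hxb (hL s).mem hle
    linarith [(hL s).residual_nonneg]

theorem continuous_inducedCost_singleAtomic (hb : IsCap c₁ c₂ M b) (h₁ : IsSmoothCost M c₁)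
    (h₂ : IsSmoothCost M c₂) (hT₀ : 0 ≤ T₀) (hT : ∀ j, 0 < T j) (hM : T₀ + ∑ j, T j + w = M) :
    Continuous fun s : Icc (0 : ℝ) w =>
      inducedCost ![c₁, c₂] T₀ T (Strategy.singleAtomic s) := by
  choose L hL using fun s : Icc (0 : ℝ) w =>
    exists_isEqLoad_strategy hb h₁ h₂ hT₀ hT hM (Strategy.singleAtomic s)
  simp only [fun s => inducedCost_eq hb h₁ h₂ hT₀ hT hM _ (hL s)]
  exact (continuousOn_loadCost h₁ h₂ T w).comp_continuous
    (continuous_load_singleAtomic hb h₁ h₂ hL) fun s => hb.Icc_subset (hL s).mem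

/-- A minimizer over the compact interval of SA strategies is optimal overall, since every strategy
shares its load, hence its cost, with an SA one. -/
theorem exists_isOptimal_singleAtomic (hb : IsCap c₁ c₂ M b) (h₁ : IsSmoothCost M c₁)
    (h₂ : IsSmoothCost M c₂) (hT₀ : 0 ≤ T₀) (hT : ∀ j, 0 < T j) (hw : 0 ≤ w)
    (hM : T₀ + ∑ j, T j + w = M) :
    ∃ s : Icc (0 : ℝ) w, IsOptimal ![c₁, c₂] T₀ T (Strategy.singleAtomic s) := by
  obtain ⟨s, -, hs⟩ := isCompact_univ.exists_isMinOn ⟨⟨0, le_rfl, hw⟩, mem_univ _⟩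
    (continuous_inducedCost_singleAtomic hb h₁ h₂ hT₀ hT hM).continuousOn
  refine ⟨s, fun α => ?_⟩
  obtain ⟨t, ht⟩ := exists_isEqLoad_strategy hb h₁ h₂ hT₀ hT hM α
  obtain ⟨s', hs'⟩ := exists_singleAtomic_isEqLoad hb h₁ h₂ hw α ht
  rw [inducedCost_eq hb h₁ h₂ hT₀ hT hM α ht, ← inducedCost_eq hb h₁ h₂ hT₀ hT hM _ hs']
  exact hs (mem_univ s')

theorem loadCost_of_activity_eq_zero {ι : Type} [Fintype ι] {T : ι → ℝ} {t : ℝ}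
    (hact : activity c₁ c₂ M T t = 0) :
    loadCost c₁ c₂ M T w t = (w - (M - t)) * c₁ t + (M - t) * c₂ (M - t) := by
  rw [loadCost, hact, gap]
  ring

/-- If the atomic opponents never use arc 2 but the undivided player does, then the trivial
strategy is the unique optimal one. -/
theorem isOptimal_iff_eq_trivial (hb : IsCap c₁ c₂ M b) (h₁ : IsSmoothCost M c₁)
    (h₂ : IsSmoothCost M c₂) (hT₀ : 0 ≤ T₀) (hT : ∀ j, 0 < T j) (hw : 0 < w)
    (hM : T₀ + ∑ j, T j + w = M) (hopp : ∀ j, T j ≤ h c₁ c₂ M b)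
    (hown : (M - b) * damping c₁ c₂ M b < w - h c₁ c₂ M b) (α : Strategy w) :
    IsOptimal ![c₁, c₂] T₀ T α ↔ α = Strategy.trivial hw := by
  have hact : ∀ {t}, t ∈ Icc 0 b → activity c₁ c₂ M T t = 0 := fun ht =>
    activity_eq_zero_iff.2 fun j => (hopp j).trans (hb.h_cap_le h₁ h₂ ht)
  have hres : ∀ {t}, t ∈ Icc 0 b →
      residual c₁ c₂ M (Sum.elim (Strategy.trivial hw).atomic T) t =
        (M - t) * damping c₁ c₂ M t - max (w - h c₁ c₂ M t) 0 := fun {t} ht => by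
    rw [residual_sumElim, residual, hact ht, sub_zero, ← Strategy.singleAtomic_self hw,
      activity_singleAtomic (hb.h_nonneg h₁ h₂ ht)]
  obtain ⟨t₀, ht₀⟩ := exists_isEqLoad_strategy hb h₁ h₂ hT₀ hT hM (Strategy.trivial hw)
  have hm₀ := hb.Icc_subset ht₀.mem
  -- By `hown` the residual of the trivial strategy is negative at the cap.
  have hlt : t₀ < b := by
    refine ht₀.mem.2.lt_of_ne fun e => ?_
    have := ht₀.residual_nonneg
    rw [hres ht₀.mem, e] at this
    linarith [le_max_left (w - h c₁ c₂ M b) 0]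
  have hz := ht₀.residual_eq_zero hlt
  have hg := one_lt_damping h₁ h₂ hm₀
  have hMt : 0 < M - t₀ := by linarith [hb.mem.2]
  have hpos : 0 < h c₁ c₂ M t₀ := hb.h_pos h₁ h₂ hm₀.1 hlt
  have hmax : max (w - h c₁ c₂ M t₀) 0 = w - h c₁ c₂ M t₀ := by
    refine max_eq_left (le_of_not_gt fun hneg => ?_)
    rw [hres ht₀.mem, max_eq_right hneg.le, sub_zero] at hz
    nlinarith
  -- With the opponents inert, this equilibrium condition is also the stationarity condition of (w -
  -- (M - t)) c₁(t) + (M - t) c₂(M - t), the cost as a function of t.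
  have hfoc : (M - t₀) * damping c₁ c₂ M t₀ = w - h c₁ c₂ M t₀ := by
    rw [hres ht₀.mem, hmax] at hz
    linarith
  have key : ∀ (β : Strategy w) {t}, IsEqLoad c₁ c₂ M b (Sum.elim β.atomic T) t →
      t ≠ t₀ → loadCost c₁ c₂ M T w t₀ < loadCost c₁ c₂ M T w t := by
    intro β t ht hne
    have hm := hb.Icc_subset ht.mem
    -- No strategy is more active than the trivial one, so t₀ is the smallest attainable load. This
    -- makes w - (M - t) nonnegative, as the convexity estimate `k₁` requires.
    have hle : t₀ ≤ t := by
      by_contra! hlt'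
      have e := hb.residual_strictAntiOn h₁ h₂ (Sum.elim (Strategy.trivial hw).atomic T)
        ht.mem ht₀.mem hlt'
      rw [hz, hres ht.mem] at e
      have e' := ht.residual_eq_zero (hlt'.trans hlt)
      rw [residual_sumElim, residual, hact ht.mem, sub_zero] at e'
      have := activity_le_max (c₁ := c₁) (c₂ := c₂) (M := M) (t := t)
        (fun i => (β.atomic_pos i).le) β.sum_atomic_le (hb.h_nonneg h₁ h₂ ht.mem)
      linarith
    rw [loadCost_of_activity_eq_zero (hact ht₀.mem), loadCost_of_activity_eq_zero (hact ht.mem)]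
    have p₁ := h₁.deriv_pos _ hm₀
    have p₂ := h₂.deriv_pos _ (sub_mem_Icc hm₀)
    have k₁ := h₁.mul_cost_ge hm₀ hm (x := w - (M - t₀)) (y := w - (M - t)) (by nlinarith)
      (by ring)
    have k₂ := h₂.mul_cost_ge (sub_mem_Icc hm₀) (sub_mem_Icc hm) (x := M - t₀) (y := M - t)
      (by linarith [hm.2]) rfl
    have hfoc' : (M - t₀) * (deriv c₁ t₀ + deriv c₂ (M - t₀)) =
        w * deriv c₁ t₀ - (c₂ (M - t₀) - c₁ t₀) := by
      rw [← damping_mul h₁ hm₀, ← mul_assoc, hfoc, sub_mul, h_mul h₁ hm₀, gap]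
    have q : 0 < (deriv c₁ t₀ + deriv c₂ (M - t₀)) * (t - t₀) ^ 2 :=
      mul_pos (by positivity) (by have := sub_ne_zero.2 hne; positivity)
    have e₁ : w - (M - t) - (w - (M - t₀)) = t - t₀ := by ring
    have e₂ : M - t - (M - t₀) = -(t - t₀) := by ring
    rw [e₁] at k₁
    rw [e₂] at k₂
    have hzero : (t - t₀) * ((c₁ t₀ + (w - (M - t₀)) * deriv c₁ t₀) -
        (c₂ (M - t₀) + (M - t₀) * deriv c₂ (M - t₀))) = 0 :=
      mul_eq_zero_of_right _ (by linarith)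
    linarith
  constructor
  · intro hα
    obtain ⟨t, ht⟩ := exists_isEqLoad_strategy hb h₁ h₂ hT₀ hT hM α
    have hle := hα (Strategy.trivial hw)
    rw [inducedCost_eq hb h₁ h₂ hT₀ hT hM α ht,
      inducedCost_eq hb h₁ h₂ hT₀ hT hM _ ht₀] at hle
    obtain rfl : t = t₀ := by
      by_contra hne
      exact (key α ht hne).not_ge hle
    -- At load t₀ < b the vanishing residual forces the deputies' activity to be w - h(t₀), which
    -- leaves only the trivial strategy.
    have e := ht.residual_eq_zero hlt
    rw [residual_sumElim, residual, hact ht.mem, sub_zero, hfoc] at e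
    refine α.eq_trivial hw hpos (by nlinarith) ?_
    change activity c₁ c₂ M α.atomic t = _
    linarith
  · rintro rfl β
    obtain ⟨t, ht⟩ := exists_isEqLoad_strategy hb h₁ h₂ hT₀ hT hM β
    rw [inducedCost_eq hb h₁ h₂ hT₀ hT hM β ht, inducedCost_eq hb h₁ h₂ hT₀ hT hM _ ht₀]
    rcases eq_or_ne t t₀ with rfl | hne
    exacts [le_rfl, (key β ht hne).le]

/-- If a player is not heavier than `h` at the equilibrium load of her opponents, then none of her
strategies changes this load. -/
theorem IsEqLoad.sumElim_of_le {t : ℝ} (ht : IsEqLoad c₁ c₂ M b T t) (hw : w ≤ h c₁ c₂ M t)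
    (α : Strategy w) : IsEqLoad c₁ c₂ M b (Sum.elim α.atomic T) t := by
  have e : activity c₁ c₂ M α.atomic t = 0 :=
    activity_eq_zero_iff.2 fun i => (α.atomic_le i).trans hw
  refine ⟨ht.mem, ?_, ?_⟩ <;> rw [residual_sumElim, e, sub_zero]
  exacts [ht.residual_nonneg, ht.residual_eq_zero]

end Cost

/-! ### The standing assumptions -/

namespace IsNetwork

variable {c₁ c₂ : ℝ → ℝ} {Ω : Set ℝ} {Mbar M : ℝ}

theorem isSmoothCost₁ (hN : IsNetwork c₁ c₂ Ω Mbar M) : IsSmoothCost M c₁ :=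
  hN.arc₁.isSmoothCost hN.isOpen hN.subset hN.lt_Mbar.le

theorem isSmoothCost₂ (hN : IsNetwork c₁ c₂ Ω Mbar M) : IsSmoothCost M c₂ :=
  hN.arc₂.isSmoothCost hN.isOpen hN.subset hN.lt_Mbar.le

theorem isCap_of_H_pos (hN : IsNetwork c₁ c₂ Ω Mbar M) (hM : 0 ≤ M) (hH : 0 < H c₁ c₂ M) :
    IsCap c₁ c₂ M M := by
  have hm : M ∈ Icc 0 M := ⟨hM, le_rfl⟩
  refine ⟨hm, Or.inl ⟨rfl, ?_⟩⟩
  have := (div_pos_iff_of_pos_right (hN.isSmoothCost₁.deriv_pos M hm)).1 hH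
  simpa [gap] using this

theorem exists_isCap_of_H_nonpos (hN : IsNetwork c₁ c₂ Ω Mbar M) (hM : 0 ≤ M)
    (hH : H c₁ c₂ M ≤ 0) :
    ∃ b, IsBalanced c₁ c₂ M b ∧ IsCap c₁ c₂ M b ∧ h c₁ c₂ M b = 0 := by
  rcases hN.arc₁_cheaper with hlt | ⟨-, -, b, hb, hbal⟩
  · exact absurd hH (not_le.2 (div_pos (sub_pos.2 hlt)
      (hN.isSmoothCost₁.deriv_pos M ⟨hM, le_rfl⟩)))
  · have hz : gap c₁ c₂ M b = 0 := sub_eq_zero.2 hb.2.symm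
    exact ⟨b, hb, ⟨hb.1, Or.inr ⟨hz, hbal⟩⟩, by
      change gap c₁ c₂ M b / _ = 0
      rw [hz, zero_div]⟩

end IsNetwork

section OpponentThreshold

variable {c₁ c₂ : ℝ → ℝ} {M b : ℝ} {m : ℕ} {T : Fin m → ℝ}

/-- The threshold `h(ξ₁)`, as an equilibrium load of the opponents below the cap. -/
theorem exists_opponentThreshold (hb : IsCap c₁ c₂ M b) (h₁ : IsSmoothCost M c₁)
    (h₂ : IsSmoothCost M c₂) (hT : ∀ j, 0 < T j) (hsum : ∑ j, T j ≤ M) :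
    ∃ t, IsEqLoad c₁ c₂ M b T t ∧ IsOpponentThreshold c₁ c₂ M T (h c₁ c₂ M t) := by
  obtain ⟨t, ht⟩ := exists_isEqLoad hb h₁ h₂ (fun j => (hT j).le) hsum
  have hM : M - ∑ j, T j + ∑ j, T j = M := by ring
  exact ⟨t, ht, _, ht.isCE hb h₁ h₂ (sub_nonneg.2 hsum) (fun j => (hT j).le) hM, by
    rw [ht.load_eqFlow_zero hb h₁ h₂ hM]⟩

end OpponentThreshold

/-- The thresholds of the theorem, together with the behaviour they govern. -/
theorem exists_thresholds {c₁ c₂ : ℝ → ℝ} {Ω : Set ℝ} {Mbar M : ℝ}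
    (hN : IsNetwork c₁ c₂ Ω Mbar M) {m : ℕ} {T : Fin m → ℝ} (hT : ∀ j, 0 < T j)
    (hsum : ∑ j, T j < M) :
    ∃ b C₀ C₁ C₂ : ℝ, IsCap c₁ c₂ M b ∧
      (0 < C₀ ∧ 0 ≤ C₁ ∧ (H c₁ c₂ M ≠ 0 → 0 < C₁) ∧ 0 < C₂) ∧
      (0 < H c₁ c₂ M → (∃ j, H c₁ c₂ M < T j) → IsOpponentThreshold c₁ c₂ M T C₀) ∧
      (H c₁ c₂ M ≤ 0 → IsBalancedThreshold c₁ c₂ M C₁) ∧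
      (H c₁ c₂ M ≤ 0 → C₁ < ∑ j, T j → IsOpponentThreshold c₁ c₂ M T C₂) ∧
      ∀ w : ℝ, 0 < w →
        (NonatomicCase (H c₁ c₂ M) C₀ C₁ C₂ T w → ∃ t, ∀ α : Strategy w,
          IsEqLoad c₁ c₂ M b (Sum.elim α.atomic T) t) ∧
        (TrivialCase (H c₁ c₂ M) C₁ T w → (∀ j, T j ≤ h c₁ c₂ M b) ∧
          (M - b) * damping c₁ c₂ M b < w - h c₁ c₂ M b) := by
  classical
  have h₁ := hN.isSmoothCost₁
  have h₂ := hN.isSmoothCost₂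
  have hM : 0 ≤ M := (Finset.sum_nonneg fun j _ => (hT j).le).trans hsum.le
  rcases lt_or_ge 0 (H c₁ c₂ M) with hH | hH
  · have hb := hN.isCap_of_H_pos hM hH
    have hHM : h c₁ c₂ M M = H c₁ c₂ M := by simp [h, H]
    have hgap : 0 < gap c₁ c₂ M M := by
      rw [← h_mul h₁ hb.mem, hHM]
      exact mul_pos hH (h₁.deriv_pos _ hb.mem)
    obtain ⟨t, ht, hthr⟩ := exists_opponentThreshold hb h₁ h₂ hT hsum.le
    -- For H > 0 the constants C₁ and C₂ play no role, so 1 is a default value.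
    refine ⟨M, h c₁ c₂ M t, 1, 1, hb, ⟨?_, zero_le_one, fun _ => one_pos, one_pos⟩,
      fun _ _ => hthr, fun e => (e.not_gt hH).elim, fun e => (e.not_gt hH).elim,
      fun w hw => ⟨?_, ?_⟩⟩
    · exact (hHM ▸ hH).trans_le (hb.h_cap_le h₁ h₂ ht.mem)
    · rintro (⟨-, ⟨hj, hle⟩ | ⟨-, -, hle⟩⟩ | ⟨e, -⟩)
      · refine ⟨M, fun α => ?_⟩
        have hact : activity c₁ c₂ M (Sum.elim α.atomic T) M = 0 := by
          refine activity_eq_zero_iff.2 (Sum.forall.2 ⟨fun i => ?_, fun j => ?_⟩) <;> rw [hHM]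
          exacts [(α.atomic_le i).trans hle, hj j]
        have hr : residual c₁ c₂ M (Sum.elim α.atomic T) M = 0 := by
          rw [residual, hact, sub_self, zero_mul, sub_zero]
        exact ⟨hb.right_mem, hr.ge, fun _ => hr⟩
      · exact ⟨t, fun α => ht.sumElim_of_le hle α⟩
      · exact (e.not_gt hH).elim
    · rintro (⟨-, hlt, hj⟩ | ⟨e, -⟩)
      · rw [hHM]
        exact ⟨hj, by linarith⟩
      · exact (e.not_gt hH).elim
  · obtain ⟨b, hbal, hb, hz⟩ := hN.exists_isCap_of_H_nonpos hM hH
    have hg := one_lt_damping h₁ h₂ hb.mem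
    have hMb : 0 ≤ M - b := sub_nonneg.2 hb.mem.2
    obtain ⟨t, ht, hthr⟩ := exists_opponentThreshold hb h₁ h₂ hT hsum.le
    -- Here C₀ is a default value. C₂ also needs one: if ∑ T j ≤ C₁, the opponents' load is b and h
    -- vanishes there.
    refine ⟨b, 1, (M - b) * damping c₁ c₂ M b,
      if (M - b) * damping c₁ c₂ M b < ∑ j, T j then h c₁ c₂ M t else 1, hb,
      ⟨one_pos, by positivity, fun hne => ?_, ?_⟩,
      fun e => (hH.not_gt e).elim, fun _ => ⟨b, hbal, rfl⟩, fun _ e => by rwa [if_pos e],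
      fun w hw => ⟨?_, ?_⟩⟩
    -- C₁ = 0 would mean b = M, and then H = h(b) = 0.
    · refine mul_pos (hMb.lt_of_ne fun e => hne ?_) (zero_lt_one.trans hg)
      obtain rfl : M = b := sub_eq_zero.1 e.symm
      rw [← hz]
      simp [h, H]
    · split_ifs with hlt
      -- At load b every opponent is fully active because h(b) = 0, so the residual would be C₁ - ∑
      -- T j < 0.
      · refine hb.h_pos h₁ h₂ ht.mem.1 (ht.mem.2.lt_of_ne ?_)
        rintro rfl
        have hact : activity c₁ c₂ M T t = ∑ j, T j :=
          Finset.sum_congr rfl fun j _ => by rw [hz, sub_zero, max_eq_left (hT j).le]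
        have := ht.residual_nonneg
        rw [residual, hact] at this
        linarith
      · exact one_pos
    · rintro (⟨e, -⟩ | ⟨-, hle | ⟨-, hlt, hle⟩⟩)
      · exact (hH.not_gt e).elim
      · refine ⟨b, fun α => ⟨hb.right_mem, ?_, fun e => (lt_irrefl _ e).elim⟩⟩
        have := activity_le_sum (sumElim_nonneg hT α) hz.ge
        simp only [Fintype.sum_sum_type, Sum.elim_inl, Sum.elim_inr] at this
        rw [residual]
        linarith [α.sum_atomic_le]
      · rw [if_pos hlt] at hle
        exact ⟨t, fun α => ht.sumElim_of_le hle α⟩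
    · rintro (⟨e, -⟩ | ⟨-, hm, hlt⟩)
      · exact (hH.not_gt e).elim
      · obtain rfl : m = 0 := by omega
        rw [hz, sub_zero]
        exact ⟨fun j => j.elim0, hlt⟩

/-! ### An instance in which only partial decentralization is optimal -/

section Instance

/-- The balanced weight is 6, since 6 = (8 - 6) + 4, and the derivative condition reads 2 ≤ 6. -/
theorem isNetwork_affine :
    IsNetwork (fun t => t) (fun t => t + 4) univ 9 8 where
  isOpen := isOpen_univ
  subset := subset_univ _
  Mbar_pos := by norm_num
  lt_Mbar := by norm_num
  arc₁ := ⟨strictMono_id.strictMonoOn _, convexOn_id convex_univ, contDiff_id.contDiffOn,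
    fun t ht => ht.1⟩
  arc₂ := ⟨(strictMono_id.add_const 4).strictMonoOn _,
    (convexOn_id convex_univ).add_const 4, (contDiff_id.add contDiff_const).contDiffOn,
    fun t ht => by linarith [ht.1]⟩
  arc₁_cheaper := Or.inr ⟨by norm_num, by norm_num, 6, ⟨by norm_num, by norm_num⟩, by
    norm_num [deriv_add_const]⟩

theorem isCap_affine : IsCap (fun t => t) (fun t => t + 4) 8 6 :=
  ⟨by norm_num, Or.inr ⟨by norm_num [gap], by norm_num [deriv_add_const]⟩⟩

theorem h_affine (t : ℝ) : h (fun t => t) (fun t => t + 4) 8 t = 12 - 2 * t := by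
  simp [h]
  ring

theorem damping_affine (t : ℝ) : damping (fun t => t) (fun t => t + 4) 8 t = 2 := by
  simp [damping]
  norm_num

/-- The cost of a single-atomic strategy in the instance with `T₀ = 0` and two atomic players of
weight 4, from the load it induces. -/
theorem inducedCost_affine (s : Icc (0 : ℝ) 4) {t : ℝ} (ht : t ∈ Icc 0 6)
    (hres : (8 - t) * 2 - max (4 - (12 - 2 * t)) 0 - max ((s : ℝ) - (12 - 2 * t)) 0 = 0) :
    inducedCost ![fun t => t, fun t => t + 4] 0 (fun _ : Fin 1 => 4) (Strategy.singleAtomic s) =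
      4 * t + (12 - 2 * t) * (8 - t - max (4 - (12 - 2 * t)) 0 / 2) := by
  have hN := isNetwork_affine
  have hload : IsEqLoad (fun t => t) (fun t => t + 4) 8 6
      (Sum.elim (Strategy.singleAtomic s).atomic fun _ : Fin 1 => 4) t := by
    have e : residual (fun t => t) (fun t => t + 4) 8
        (Sum.elim (Strategy.singleAtomic s).atomic fun _ : Fin 1 => 4) t = 0 := by
      have hact : activity (fun t => t) (fun t => t + 4) 8 (fun _ : Fin 1 => 4) t =
          max (4 - (12 - 2 * t)) 0 := by
        simp [activity, h_affine]
      rw [residual_sumElim, activity_singleAtomic (by rw [h_affine]; linarith [ht.2]),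
        residual, damping_affine, h_affine, hact]
      exact hres
    exact ⟨ht, e.ge, fun _ => e⟩
  rw [inducedCost_eq isCap_affine hN.isSmoothCost₁ hN.isSmoothCost₂ le_rfl
    (fun _ => by norm_num) (by norm_num) _ hload]
  simp only [loadCost, damping_affine, gap, activity, h_affine, Finset.univ_unique,
    Finset.sum_const, Finset.card_singleton, one_smul]
  ring

end Instance

end CompositeCongestion

end

/-! ### The main theorem -/

theorem theorem2 :
    (∀ (c₁ c₂ : ℝ → ℝ) (Ω : Set ℝ) (Mbar M : ℝ),
      CompositeCongestion.IsNetwork c₁ c₂ Ω Mbar M →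
      ∀ (m : ℕ) (T : Fin m → ℝ), (∀ j, 0 < T j) → ∑ j, T j < M →
      ∃ C₀ C₁ C₂ : ℝ,
        -- the constants depend only on the costs, on `M` and on `T`
        (0 < C₀ ∧ 0 ≤ C₁ ∧ (CompositeCongestion.H c₁ c₂ M ≠ 0 → 0 < C₁) ∧ 0 < C₂) ∧
        (0 < CompositeCongestion.H c₁ c₂ M → (∃ j, CompositeCongestion.H c₁ c₂ M < T j) →
          CompositeCongestion.IsOpponentThreshold c₁ c₂ M T C₀) ∧
        (CompositeCongestion.H c₁ c₂ M ≤ 0 →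
          CompositeCongestion.IsBalancedThreshold c₁ c₂ M C₁) ∧
        (CompositeCongestion.H c₁ c₂ M ≤ 0 → C₁ < ∑ j, T j →
          CompositeCongestion.IsOpponentThreshold c₁ c₂ M T C₂) ∧
        ∀ (T₀ TN : ℝ) (_ : 0 ≤ T₀) (hTN : 0 < TN) (_ : T₀ + ∑ j, T j + TN = M),
          -- the cost of every strategy is well defined
          (∀ α : CompositeCongestion.Strategy TN,
            (∃! z, CompositeCongestion.IsInducedCE ![c₁, c₂] T₀ T α z) ∧
            ∃! u, CompositeCongestion.IsInducedCost ![c₁, c₂] T₀ T α u) ∧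
          -- existence of an optimal strategy, among the single-atomic ones
          (Continuous fun s : Set.Icc (0 : ℝ) TN =>
            CompositeCongestion.inducedCost ![c₁, c₂] T₀ T
              (CompositeCongestion.Strategy.singleAtomic s)) ∧
          (∃ s : Set.Icc (0 : ℝ) TN, CompositeCongestion.IsOptimal ![c₁, c₂] T₀ T
            (CompositeCongestion.Strategy.singleAtomic s)) ∧
          -- nonatomic case
          (CompositeCongestion.NonatomicCase (CompositeCongestion.H c₁ c₂ M) C₀ C₁ C₂ T TN →
            ∀ α : CompositeCongestion.Strategy TN,
              CompositeCongestion.IsOptimal ![c₁, c₂] T₀ T α ∧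
              CompositeCongestion.AreEquivalent ![c₁, c₂] T₀ T α
                (CompositeCongestion.Strategy.allNonatomic hTN.le)) ∧
          -- trivial case
          (CompositeCongestion.TrivialCase (CompositeCongestion.H c₁ c₂ M) C₁ T TN →
            ∀ α : CompositeCongestion.Strategy TN,
              CompositeCongestion.IsOptimal ![c₁, c₂] T₀ T α ↔
                α = CompositeCongestion.Strategy.trivial hTN) ∧
          -- nontrivial case
          (¬ CompositeCongestion.NonatomicCase (CompositeCongestion.H c₁ c₂ M) C₀ C₁ C₂ T TN →
            ¬ CompositeCongestion.TrivialCase (CompositeCongestion.H c₁ c₂ M) C₁ T TN →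
            ∃ α : CompositeCongestion.Strategy TN,
              CompositeCongestion.IsOptimal ![c₁, c₂] T₀ T α)) ∧
    -- the optimum is not necessarily nonatomic or trivial
    (∃ (c₁ c₂ : ℝ → ℝ) (Ω : Set ℝ) (Mbar M : ℝ) (m : ℕ) (T : Fin m → ℝ) (T₀ TN : ℝ)
      (hTN : 0 < TN),
      CompositeCongestion.IsNetwork c₁ c₂ Ω Mbar M ∧ (∀ j, 0 < T j) ∧ 0 ≤ T₀ ∧
      T₀ + ∑ j, T j + TN = M ∧
      ¬ CompositeCongestion.IsOptimal ![c₁, c₂] T₀ T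
          (CompositeCongestion.Strategy.allNonatomic hTN.le) ∧
      ¬ CompositeCongestion.IsOptimal ![c₁, c₂] T₀ T
          (CompositeCongestion.Strategy.trivial hTN)) := by
  open CompositeCongestion in
  refine ⟨fun c₁ c₂ Ω Mbar M hN m T hT hsum => ?_, ?_⟩
  · obtain ⟨b, C₀, C₁, C₂, hb, hC, hC₀, hC₁, hC₂, hcases⟩ := exists_thresholds hN hT hsum
    refine ⟨C₀, C₁, C₂, hC, hC₀, hC₁, hC₂, fun T₀ TN hT₀ hTN hM => ?_⟩
    have h₁ := hN.isSmoothCost₁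
    have h₂ := hN.isSmoothCost₂
    obtain ⟨s, hs⟩ := exists_isOptimal_singleAtomic hb h₁ h₂ hT₀ hT hTN.le hM
    refine ⟨fun α => ⟨existsUnique_isCE hb h₁ h₂ (add_nonneg α.nonatomic_nonneg hT₀)
        (sumElim_nonneg hT α) (total_sumElim hM α), ?_⟩,
      continuous_inducedCost_singleAtomic hb h₁ h₂ hT₀ hT hM, ⟨s, hs⟩, fun hcase α => ?_,
      fun hcase α => ?_, fun _ _ => ⟨_, hs⟩⟩
    · obtain ⟨t, ht⟩ := exists_isEqLoad_strategy hb h₁ h₂ hT₀ hT hM α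
      simp only [isInducedCost_iff hb h₁ h₂ hT₀ hT hM α ht]
      exact existsUnique_eq
    · obtain ⟨t, ht⟩ := (hcases TN hTN).1 hcase
      exact isOptimal_of_forall_isEqLoad hb h₁ h₂ hT₀ hT hM ht α _
    · obtain ⟨hopp, hown⟩ := (hcases TN hTN).2 hcase
      exact isOptimal_iff_eq_trivial hb h₁ h₂ hT₀ hT hTN hM hopp hown α
  · have h4 : (0 : ℝ) < 4 := by norm_num
    -- The SA strategies s = 0, 3, 4 induce the loads 6, 11/2, 16/3 and the costs 24, 23, 208/9, so
    -- s = 3 beats both the nonatomic and the trivial strategy.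
    refine ⟨fun t => t, fun t => t + 4, univ, 9, 8, 1, fun _ => 4, 0, 4, h4,
      isNetwork_affine, fun _ => h4, le_rfl, by norm_num, fun hopt => ?_, fun hopt => ?_⟩
    · have := hopt (Strategy.singleAtomic ⟨3, by norm_num, by norm_num⟩)
      rw [← Strategy.singleAtomic_zero h4.le, inducedCost_affine _ (t := 6) (by norm_num)
        (by norm_num), inducedCost_affine _ (t := 11 / 2) (by norm_num) (by norm_num)] at this
      norm_num at this
    · have := hopt (Strategy.singleAtomic ⟨3, by norm_num, by norm_num⟩)
      rw [← Strategy.singleAtomic_self h4, inducedCost_affine _ (t := 16 / 3) (by norm_num)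
        (by norm_num), inducedCost_affine _ (t := 11 / 2) (by norm_num) (by norm_num)] at this
      norm_num at this
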